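/- Setting. A probabilistic transition system (PTS) has a set of states with an initial state, actions, and transitions $(s,a,\mu)$ with $\mu$ a discrete distribution over states. A strategy maps each finite run to a discrete distribution over the transitions that leave its last state (only runs that the strategy itself generates from the initial state matter). A clock-dependent probabilistic timed automaton (cdPTA) $\mathcal P$ has a finite set $L$ of locations with an initial location $\bar l$, a finite set $\mathcal X$ of clocks, for each location $l$ an invariant $\mathit{inv}(l)$, and a set of probabilistic edges $(l,g,\mathfrak p)$. Invariants and guards $g$ are finite conjunctions of constraints $x\sim c$ with $\sim\,\in\{<,\le,\ge,>\}$ and $c\in\mathbb N$; the template $\mathfrak p$ gives for each clock valuation $v:\mathcal X\to\mathbb R_{\ge0}$ a distribution $\mathfrak p[v]$ over pairs $(X,l')$ of a set $X\subseteq\mathcal X$ of clocks to reset and a target location $l'$. Write $v[X:=0]$ for $v$ with the clocks of $X$ reset to $0$. Assume: the zero valuation satisfies $\mathit{inv}(\bar l)$; from every $(l,v)$ with $v\models\mathit{inv}(l)$ one can, after some delay $\delta\ge 0$ during which $\mathit{inv}(l)$ holds, take a probabilistic edge; each $\mathit{inv}(l)$ contains for each clock $x$ a constraint $x\le c$ or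 $x<c$; if $v\models g$ and $\mathfrak p[v](X,l')>0$, then $v[X:=0]\models\mathit{inv}(l')$; $v\models g$ implies $v\models \mathit{inv}(l)$ for every edge $(l,g,\mathfrak p)$; and every edge is piecewise linear, i.e. for all $v\models g$ and all $e$, $\mathfrak p[v](e)=\sum_{x\in\mathcal X}f^{e}_x(v(x))$, where $f^e_x$ is continuous on $\{v(x): v\models g\}$ and affine with rational coefficients on each member of a partition of this set into intervals with natural endpoints. Let $M\in\mathbb N$ be an upper bound on all clock values allowed by the invariants. The semantics $[\![\mathcal P]\!]$ is the PTS whose states are the pairs $(l,v)$ with $v\models\mathit{inv}(l)$, with initial state $(\bar l,\mathbf 0)$; a time transition leads from $(l,v)$ to $(l,v+\delta)$ if $v+\delta'\models\mathit{inv}(l)$ for all $0\le\delta'\le\delta$, and an edge transition via $(l,g,\mathfrak p)$ with $v\models g$ leads to $(l',v')$ with probability $\sum_{X:\,v[X:=0]=v'}\mathfrak p[v](X,l')$. For an integer $k\ge1$, a $k$-region $R=(h,[X_0,\dots,X_n])$ consists of $h:\mathcal X\to\frac1k\mathbb N\cap[0,M]$ and an ordered partition of $\mathcal X$ with $X_1,\dots,X_n$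 non-empty such that $h(x)=M$ implies $x\in X_0$. It contains the valuations $v$ with $\lfloor k\,v(x)\rfloor=k\,h(x)$ for all $x$, $v(x)=h(x)$ if and only if $x\in X_0$, and clocks ordered by the fractional part of $k\,v(x)$ exactly as by their block index. $R\models g$ means that every valuation in $R$ satisfies $g$, and $R[X:=0]$ is the $k$-region containing $v[X:=0]$ for all $v\in R$. The corner points of $R$ are $a_0,\dots,a_n$ with $a_i(x)=h(x)$ if $x\in X_j$, $j\le i$, and $a_i(x)=h(x)+\frac1k$ otherwise. The clock-dependent region graph $\mathcal A_k$ is the PTS with states $(l,R)$, where $l\in L$ and $R$ is a $k$-region, and as initial state $\bar l$ with the region of the zero valuation. It has a time transition from $(l,R)$ to $(l,R')$ if there are $v\in R$ and $\delta\ge0$ with $v+\delta\in R'$ and $v+\delta'\models\mathit{inv}(l)$ for all $0\le\delta'\le\delta$. For each edge $(l,g,\mathfrak p)$ with $R\models g$ and each corner point $\alpha$ of $R$, it has an edge transition from $(l,R)$ to $(l',R')$ with probability $\sum_{X:\,R[X:=0]=R'}\mathfrak p[\alpha](X,l')$, where $\mathfrak p[\alpha](e)$ is the limit of $\mathfrak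 p[v](e)$ as $v\to\alpha$ with $v\models g$. Fix a set $F\subseteq L$ of target locations. For each of these PTSs, let $\mathrm{Max}$ and $\mathrm{Min}$ be the supremum and the infimum, over all strategies that alternate between time transitions and edge transitions (starting with either kind), of the probability of visiting, from the initial state, a state whose location is in $F$. Proposition. For every integer $k\ge1$: (1) $\mathrm{Max}([\![\mathcal P]\!])\le\mathrm{Max}(\mathcal A_k)$ and $\mathrm{Min}([\![\mathcal P]\!])\ge\mathrm{Min}(\mathcal A_k)$. (2) $\mathrm{Max}(\mathcal A_{2k})\le\mathrm{Max}(\mathcal A_k)$ and $\mathrm{Min}(\mathcal A_{2k})\ge\mathrm{Min}(\mathcal A_k)$. -/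

import Mathlib

open Set Filter Topology MeasureTheory ProbabilityTheory
open scoped NNReal ENNReal

noncomputable section

/-! ## Probabilistic transition systems

`Dist(Q)` is `PMF Q`: functions on `Q` with countable support and total mass one. -/

/-- A probabilistic transition system with states `S` and actions `A`. -/
structure PTS (S A : Type*) where
  init : S
  trans : Set (S × A × PMF S)

/-- Finite runs `s₀ -(a₀,μ₀)→ s₁ -(a₁,μ₁)→ ⋯ sₙ`. -/
inductive FinRun (S A : Type*) where
  | start (s : S) : FinRun S A
  | step (r : FinRun S A) (a : A) (μ : PMF S) (s : S) : FinRun S A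

namespace FinRun

variable {S A : Type*}

/-- The last state of a finite run. -/
def last : FinRun S A → S
  | start s => s
  | step _ _ _ s => s

/-- Every set of finite runs is measurable (all distributions involved are discrete). -/
instance : MeasurableSpace (FinRun S A) := ⊤

end FinRun

namespace PTS

variable {S A : Type*}

/-- The type of (candidate) strategies: a distribution over transitions for each finite run. -/
abbrev StrategyFun (S A : Type*) := FinRun S A → PMF (S × A × PMF S)

/-- The finite runs from the initial state that result from the choices of `σ`. -/
inductive Generated (T : PTS S A) (σ : StrategyFun S A) : FinRun S A → Prop
  | start : Generated T σ (FinRun.start T.init)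
  | step {r : FinRun S A} {a : A} {μ : PMF S} {s : S} :
      Generated T σ r → (r.last, a, μ) ∈ (σ r).support → s ∈ μ.support →
      Generated T σ (r.step a μ s)

/-- `σ` is a strategy of `T`: along the runs that it generates from the initial state, it only
chooses transitions of `T` that leave the current state. (Its values on other runs are
irrelevant for all probabilities from the initial state.) -/
def IsStrategy (T : PTS S A) (σ : StrategyFun S A) : Prop :=
  ∀ r, T.Generated σ r → ∀ t ∈ (σ r).support, t ∈ T.trans ∧ t.1 = r.last

/-- `σ` alternates between the transitions in `D` and the transitions in `E`; the first
transition may be of either kind. -/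
def Alternates (T : PTS S A) (D E : Set (S × A × PMF S)) (σ : StrategyFun S A) : Prop :=
  ∀ r a μ s, T.Generated σ (FinRun.step r a μ s) →
    ((r.last, a, μ) ∈ D ∧ (σ (r.step a μ s)).support ⊆ E) ∨
    ((r.last, a, μ) ∈ E ∧ (σ (r.step a μ s)).support ⊆ D)

/-- The law of the one-step extension of the finite run `r` under `σ`: choose a transition
according to `σ r`, then a target state according to its distribution. -/
def next (σ : StrategyFun S A) (r : FinRun S A) : PMF (FinRun S A) :=
  (σ r).bind fun t => t.2.2.map fun s => r.step t.2.1 t.2.2 s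

/-- The kernel that gives the finite run with `n + 1` transitions from its predecessors. -/
def nextKernel (σ : StrategyFun S A) (n : ℕ) :
    Kernel (Π _ : Finset.Iic n, FinRun S A) (FinRun S A) where
  toFun h := (next σ (h ⟨n, Finset.mem_Iic.2 le_rfl⟩)).toMeasure
  measurable' := (measurable_from_top (f := fun r : FinRun S A => (next σ r).toMeasure)).comp
    (measurable_pi_apply _)

instance (σ : StrategyFun S A) (n : ℕ) : IsMarkovKernel (nextKernel σ n) :=
  ⟨fun h => PMF.toMeasure.isProbabilityMeasure (next σ (h ⟨n, Finset.mem_Iic.2 le_rfl⟩))⟩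

/-- The probability measure over infinite runs from the initial state induced by `σ`
(Ionescu-Tulcea). An infinite run is given by the sequence `ω` of its finite prefixes: `ω n` is
the prefix with `n` transitions. -/
def runMeasure (T : PTS S A) (σ : StrategyFun S A) : Measure (ℕ → FinRun S A) :=
  Kernel.trajMeasure (X := fun _ => FinRun S A)
    (Measure.dirac (FinRun.start T.init)) (nextKernel σ)

/-- The probability, under `σ` and from the initial state, of visiting a state of `F`. -/
def probReach (T : PTS S A) (σ : StrategyFun S A) (F : Set S) : ℝ≥0∞ :=
  T.runMeasure σ {ω | ∃ i, (ω i).last ∈ F}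

/-- The maximum value over the strategies in `C` with respect to `F`. -/
def maxVal (T : PTS S A) (F : Set S) (C : Set (StrategyFun S A)) : ℝ≥0∞ :=
  ⨆ σ ∈ C, T.probReach σ F

/-- The minimum value over the strategies in `C` with respect to `F`. -/
def minVal (T : PTS S A) (F : Set S) (C : Set (StrategyFun S A)) : ℝ≥0∞ :=
  ⨅ σ ∈ C, T.probReach σ F

end PTS

/-! ## Clock valuations and clock constraints -/

/-- Clock valuations. -/
abbrev Val (X : Type*) := X → ℝ≥0

namespace Val

variable {X : Type*}

/-- `v + δ`: all clocks advance by `δ`. -/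
def delay (v : Val X) (δ : ℝ≥0) : Val X := fun x => v x + δ

/-- `v[Y := 0]`: the clocks in `Y` are reset to `0`. -/
def reset [DecidableEq X] (v : Val X) (Y : Finset X) : Val X := fun x => if x ∈ Y then 0 else v x

end Val

/-- Comparison operators of atomic clock constraints. -/
inductive Cmp where
  | lt
  | le
  | ge
  | gt

/-- The meaning of a comparison operator. -/
def Cmp.holds : Cmp → ℝ≥0 → ℝ≥0 → Prop
  | lt, a, b => a < b
  | le, a, b => a ≤ b
  | ge, a, b => b ≤ a
  | gt, a, b => b < a

/-- Atomic clock constraints `x ∼ c`. -/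
structure Atom (X : Type*) where
  clock : X
  cmp : Cmp
  const : ℕ

/-- Clock constraints: finite conjunctions of atomic constraints. -/
abbrev ClockConstraint (X : Type*) := List (Atom X)

/-- `v` satisfies `ψ`. -/
def Val.Sat {X : Type*} (v : Val X) (ψ : ClockConstraint X) : Prop :=
  ∀ a ∈ ψ, a.cmp.holds (v a.clock) (a.const : ℝ≥0)

/-! ## Clock-dependent probabilistic timed automata -/

/-- Probabilistic edges `(l, g, 𝔭)`, where `𝔭` is a distribution template over pairs of a set of
clocks to be reset and a target location. -/
structure ProbEdge (L X : Type*) where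
  source : L
  guard : ClockConstraint X
  templ : Val X → PMF (Finset X × L)

namespace ProbEdge

variable {L X : Type*}

/-- The set of values that the clock `x` takes in valuations satisfying the guard. -/
def interval (p : ProbEdge L X) (x : X) : Set ℝ≥0 := {γ | ∃ v : Val X, v.Sat p.guard ∧ v x = γ}

/-- The probability that the template gives to `e` at the point `α`, understood by continuity:
the limit of `𝔭[v](e)` as `v` tends to `α` among the valuations that satisfy the guard. (For a
piecewise linear edge it is `𝔭[α](e)` if `α` satisfies the guard; if `α` is only in the closure
of the guard, it is the sum of the continuous extensions of the piecewise linear functions.) -/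
def probAt (p : ProbEdge L X) (α : Val X) (e : Finset X × L) : ℝ :=
  extendFrom {v : Val X | v.Sat p.guard} (fun v => (p.templ v e).toReal) α

end ProbEdge

/-- Bounded intervals (open, closed or half-open) whose endpoints are natural numbers. -/
def IsNatInterval (J : Set ℝ≥0) : Prop :=
  ∃ a b : ℕ, J = Icc (a : ℝ≥0) b ∨ J = Ico (a : ℝ≥0) b ∨ J = Ioc (a : ℝ≥0) b ∨ J = Ioo (a : ℝ≥0) b

/-- `f` is continuous and piecewise linear on `I`, with rational coefficients on the members of
a partition of `I` into intervals with natural endpoints. -/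
def IsContPiecewiseLinear (I : Set ℝ≥0) (f : ℝ≥0 → ℝ) : Prop :=
  ContinuousOn f I ∧
  ∃ 𝓘 : Set (Set ℝ≥0), (∀ J ∈ 𝓘, IsNatInterval J) ∧ ⋃₀ 𝓘 = I ∧ 𝓘.PairwiseDisjoint id ∧
    ∀ J ∈ 𝓘, ∃ c d : ℚ, ∀ γ ∈ J, f γ = (c : ℝ) + (d : ℝ) * (γ : ℝ)

/-- The edge is piecewise linear: on the guard, the probability of each outcome `e` is a sum over
the clocks of continuous piecewise linear functions. (Since `𝔭[v]` is a distribution, the sums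
lie in `[0,1]` and add up to `1`.) -/
def ProbEdge.IsPiecewiseLinear {L X : Type*} [Fintype X] (p : ProbEdge L X) : Prop :=
  ∃ f : Finset X × L → X → ℝ≥0 → ℝ,
    (∀ e x, IsContPiecewiseLinear (p.interval x) (f e x)) ∧
    ∀ v : Val X, v.Sat p.guard → ∀ e, (p.templ v e).toReal = ∑ x, f e x (v x)

/-- Clock-dependent probabilistic timed automata with locations `L` and clocks `X`; the initial
state satisfies its invariant. -/
structure CdPTA (L X : Type*) where
  init : L
  inv : L → ClockConstraint X
  prob : Set (ProbEdge L X)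
  init_sat : Val.Sat (fun _ => 0) (inv init)

namespace CdPTA

variable {L X : Type*}

/-- The standing assumptions on cdPTAs. -/
structure Standing [Fintype X] [DecidableEq X] (P : CdPTA L X) : Prop where
  /-- it is always possible to take a probabilistic edge, immediately or after some delay -/
  progress : ∀ l (v : Val X), v.Sat (P.inv l) → ∃ δ : ℝ≥0,
    (∀ δ' ≤ δ, (v.delay δ').Sat (P.inv l)) ∧
    ∃ p ∈ P.prob, p.source = l ∧ (v.delay δ).Sat p.guard
  /-- every invariant has an upper bound `x ≤ c` or `x < c` for every clock -/
  bounded : ∀ l x, ∃ a ∈ P.inv l, a.clock = x ∧ (a.cmp = Cmp.le ∨ a.cmp = Cmp.lt)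
  /-- target states of probabilistic edges satisfy their invariants -/
  target_sat : ∀ p ∈ P.prob, ∀ v : Val X, v.Sat p.guard → ∀ Y l', 0 < p.templ v (Y, l') →
    (v.reset Y).Sat (P.inv l')
  /-- guards imply the invariant of the source location -/
  guard_sat : ∀ p ∈ P.prob, ∀ v : Val X, v.Sat p.guard → v.Sat (P.inv p.source)
  /-- all probabilistic edges are piecewise linear -/
  piecewiseLinear : ∀ p ∈ P.prob, p.IsPiecewiseLinear

/-- `M` is an upper bound on the clocks of `P`. -/
def ClockBound (P : CdPTA L X) (M : ℕ) : Prop :=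
  ∀ l (v : Val X), v.Sat (P.inv l) → ∀ x, v x ≤ M

/-- States `(l, v)` of the cdPTA, where `v` satisfies the invariant of `l`. -/
@[ext]
structure State (P : CdPTA L X) where
  loc : L
  val : Val X
  sat : val.Sat (P.inv loc)

/-- Actions of the semantics: delays and probabilistic edges. -/
inductive Action (L X : Type*) where
  | delay (δ : ℝ≥0) : Action L X
  | edge (p : ProbEdge L X) : Action L X

/-- Time elapse transitions: delay by `δ` while the invariant holds continuously. -/
def timeTrans (P : CdPTA L X) : Set (P.State × Action L X × PMF P.State) :=
  {t | ∃ (s s' : P.State) (δ : ℝ≥0),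
    (∀ δ' ≤ δ, (s.val.delay δ').Sat (P.inv s.loc)) ∧
    s'.loc = s.loc ∧ s'.val = s.val.delay δ ∧
    t = (s, Action.delay δ, PMF.pure s')}

open Classical in
/-- Probabilistic edge transitions:
`μ(l', v') = ∑ 𝔭[v](Y, l')`, over the clock sets `Y` with `v[Y := 0] = v'`. -/
def edgeTrans [Fintype X] [DecidableEq X] (P : CdPTA L X) :
    Set (P.State × Action L X × PMF P.State) :=
  {t | ∃ (s : P.State) (p : ProbEdge L X) (μ : PMF P.State),
    p ∈ P.prob ∧ p.source = s.loc ∧ s.val.Sat p.guard ∧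
    (∀ s' : P.State, μ s' =
      ∑ Y ∈ Finset.univ.filter (fun Y : Finset X => s.val.reset Y = s'.val),
        p.templ s.val (Y, s'.loc)) ∧
    t = (s, Action.edge p, μ)}

/-- The semantics of a cdPTA as a probabilistic transition system. -/
def sem [Fintype X] [DecidableEq X] (P : CdPTA L X) : PTS P.State (Action L X) where
  init := ⟨P.init, fun _ => 0, P.init_sat⟩
  trans := P.timeTrans ∪ P.edgeTrans

/-- The cdPTA strategies: those alternating between time elapse and probabilistic edges. -/
def strategies [Fintype X] [DecidableEq X] (P : CdPTA L X) :
    Set (PTS.StrategyFun P.State (Action L X)) :=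
  {σ | P.sem.IsStrategy σ ∧ P.sem.Alternates P.timeTrans P.edgeTrans σ}

/-- The states whose location is a target location. -/
def targets (P : CdPTA L X) (F : Set L) : Set P.State := {s | s.loc ∈ F}

end CdPTA

/-! ## Regions of granularity `1/k` -/

/-- A `k`-region `(h, [X₀, …, Xₙ])` with clocks bounded by `M`: `h x = num x / k` is a multiple of
`1/k` in `[0, M]`, and `Xᵢ` is the set of clocks `x` with `block x = i`. The blocks `X₁, …, Xₙ`
are non-empty. -/
@[ext]
structure Region (X : Type*) (M k : ℕ) where
  n : ℕ
  num : X → ℕ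
  block : X → ℕ
  num_le : ∀ x, num x ≤ M * k
  block_le : ∀ x, block x ≤ n
  block_nonempty : ∀ i, 1 ≤ i → i ≤ n → ∃ x, block x = i
  block_top : ∀ x, num x = M * k → block x = 0

namespace Region

variable {X : Type*} {M k : ℕ}

/-- The function `h` of the region. -/
def h (R : Region X M k) (x : X) : ℝ≥0 := (R.num x : ℝ≥0) / k

/-- The valuation `v` belongs to the region `R`. The clocks in `X₀` are exactly those whose value
is `h x`; the blocks order the clocks by the fractional parts of `k * v x`. -/
def Mem (R : Region X M k) (v : Val X) : Prop :=
  (∀ x, ⌊(k : ℝ) * v x⌋ = (R.num x : ℤ)) ∧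
  (∀ x, v x = R.h x ↔ R.block x = 0) ∧
  ∀ x y, Int.fract ((k : ℝ) * v x) ≤ Int.fract ((k : ℝ) * v y) ↔ R.block x ≤ R.block y

/-- All valuations of the region satisfy `ψ`. -/
def Sat (R : Region X M k) (ψ : ClockConstraint X) : Prop := ∀ v, R.Mem v → v.Sat ψ

/-- `R'` is a `ψ`-satisfying time successor of `R`. -/
def TimeSucc (ψ : ClockConstraint X) (R R' : Region X M k) : Prop :=
  ∃ (v : Val X) (δ : ℝ≥0), R.Mem v ∧ R'.Mem (v.delay δ) ∧ ∀ δ' ≤ δ, (v.delay δ').Sat ψ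

/-- `R[Y := 0] = R'`: the region `R'` contains the valuations `v[Y := 0]` for `v` in `R`. -/
def IsReset [DecidableEq X] (R : Region X M k) (Y : Finset X) (R' : Region X M k) : Prop :=
  ∀ v, R.Mem v → R'.Mem (v.reset Y)

/-- The region that consists of the zero valuation, see `mem_zero`. -/
def zero (X : Type*) (M k : ℕ) : Region X M k where
  n := 0
  num _ := 0
  block _ := 0
  num_le _ := Nat.zero_le _
  block_le _ := le_rfl
  block_nonempty i h1 h0 := absurd (h1.trans h0) (by decide)
  block_top _ _ := rfl

theorem mem_zero : (zero X M k).Mem (fun _ => 0) := by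
  simp [Mem, zero, h]

/-- The corner point `aᵢ`: the clocks in `Xⱼ` have value `h x` if `j ≤ i`, and `h x + 1/k` if
`j > i`. -/
def corner (R : Region X M k) (i : ℕ) : Val X :=
  fun x => if R.block x ≤ i then R.h x else R.h x + 1 / k

/-- The set of the corner points `a₀, …, aₙ` of a region. -/
def corners (R : Region X M k) : Set (Val X) := {α | ∃ i ≤ R.n, α = R.corner i}

end Region

/-! ## The clock-dependent region graph -/

namespace CdPTA

variable {L X : Type*}

/-- States of the region graph. -/
abbrev RState (L X : Type*) (M k : ℕ) := L × Region X M k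

/-- Actions of the region graph: time elapse, or a corner point with a probabilistic edge. -/
inductive RAction (L X : Type*) where
  | tau : RAction L X
  | edge (α : Val X) (p : ProbEdge L X) : RAction L X

/-- Time elapse transitions of the region graph. -/
def rTimeTrans (P : CdPTA L X) (M k : ℕ) :
    Set (RState L X M k × RAction L X × PMF (RState L X M k)) :=
  {t | ∃ (l : L) (R R' : Region X M k), Region.TimeSucc (P.inv l) R R' ∧
    t = ((l, R), RAction.tau, PMF.pure (l, R'))}

open Classical in
/-- Probabilistic edge transitions of the region graph:
`ν(l', R') = ∑ 𝔭[α](Y, l')`, over the clock sets `Y` with `R[Y := 0] = R'`. -/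
def rEdgeTrans [Fintype X] [DecidableEq X] (P : CdPTA L X) (M k : ℕ) :
    Set (RState L X M k × RAction L X × PMF (RState L X M k)) :=
  {t | ∃ (l : L) (R : Region X M k) (α : Val X) (p : ProbEdge L X) (ν : PMF (RState L X M k)),
    p ∈ P.prob ∧ p.source = l ∧ R.Sat p.guard ∧ α ∈ R.corners ∧
    (∀ (l' : L) (R' : Region X M k), (ν (l', R')).toReal =
      ∑ Y ∈ Finset.univ.filter (fun Y : Finset X => R.IsReset Y R'), p.probAt α (Y, l')) ∧
    t = ((l, R), RAction.edge α p, ν)}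

/-- The clock-dependent region graph of `P` with granularity `k`. -/
def regionGraph [Fintype X] [DecidableEq X] (P : CdPTA L X) (M k : ℕ) :
    PTS (RState L X M k) (RAction L X) where
  init := (P.init, Region.zero X M k)
  trans := P.rTimeTrans M k ∪ P.rEdgeTrans M k

/-- The region graph strategies: those alternating between time elapse and probabilistic
edges. -/
def rStrategies [Fintype X] [DecidableEq X] (P : CdPTA L X) (M k : ℕ) :
    Set (PTS.StrategyFun (RState L X M k) (RAction L X)) :=
  {σ | (P.regionGraph M k).IsStrategy σ ∧
    (P.regionGraph M k).Alternates (P.rTimeTrans M k) (P.rEdgeTrans M k) σ}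

/-- The states of the region graph whose location is a target location. -/
def rTargets (F : Set L) (X : Type*) (M k : ℕ) : Set (RState L X M k) := {s | s.1 ∈ F}

end CdPTA

end

/-!
Both parts are instances of one transfer principle: if a map `f` from the states of one transition
system to those of another one matches every transition by a randomized choice of transitions of
the same kind, with the image under `f` as the resulting distribution, then every alternating
strategy of the first system has an imitation in the second with the same reachability probability
(`PTS.exists_strategy_of_simulation`). Every probability that the first system achieves is thus
achieved by the second, so the supremum of the second is at least as large and its infimum at most
as large. The
imitating strategy knows only its own run; it draws a run of the first system from the conditional
law given that run, under a coupling of the two systems (`PTS.coupledLaw`). The reachability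
probability is computed from the laws of the finite runs alone (`PTS.probReach_eq_iSup`).

The map sends `(l, v)` to `(l, R)` with the `k`-region `R` of `v`, respectively `(l, R₂)` with a
`2k`-region `R₂` to `(l, R)` with the `k`-region `R ⊇ R₂`. Time transitions are matched by time
transitions. For an edge, let `α` be the valuation `v`, respectively a corner point of `R₂`; in
both cases `α` lies in the closure of `R`. On this closure the limit probabilities of an edge are
an affine function of the point (`ProbEdge.exists_affine`), because a region lies in one piece of
each piecewise linear function, and `α` is a convex combination of the corner points of `R`
(`Region.exists_weights`). Hence choosing the corner point at random with these weights gives the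
distribution of the edge at `α` (`CdPTA.exists_corner_choice`). The effect of resets on
regions is the same for all valuations of a region, so the target distributions agree as well.
-/

noncomputable section

/-! ### Reachability probabilities through the laws of finite runs -/

namespace FinRun

variable {S A : Type*}

/-- The run passes through a state of `F`. -/
def Visits (F : Set S) : FinRun S A → Prop
  | start s => s ∈ F
  | step r _ _ s => r.Visits F ∨ s ∈ F

/-- The number of transitions of a finite run. -/
def length : FinRun S A → ℕ
  | start _ => 0
  | step r _ _ _ => r.length + 1

end FinRun

namespace PTS

variable {S A : Type*}

/-- The law of the finite run that consists of the first `n` transitions under `σ`. -/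
def runLaw (T : PTS S A) (σ : StrategyFun S A) : ℕ → PMF (FinRun S A)
  | 0 => PMF.pure (FinRun.start T.init)
  | n + 1 => (T.runLaw σ n).bind (next σ)

theorem mem_support_next {σ : StrategyFun S A} {r r' : FinRun S A}
    (h : r' ∈ (next σ r).support) :
    ∃ t ∈ (σ r).support, ∃ s ∈ t.2.2.support, r' = r.step t.2.1 t.2.2 s := by
  simp only [next, PMF.mem_support_bind_iff, PMF.support_map, mem_image] at h
  obtain ⟨t, ht, s, hs, rfl⟩ := h
  exact ⟨t, ht, s, hs, rfl⟩

theorem exists_mem_support_runLaw_of_generated {T : PTS S A} {σ : StrategyFun S A}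
    {r : FinRun S A} (h : T.Generated σ r) : ∃ n, r ∈ (T.runLaw σ n).support := by
  induction h with
  | start => exact ⟨0, by simp [runLaw]⟩
  | @step r a μ s _ ht hs ih =>
    obtain ⟨n, hn⟩ := ih
    refine ⟨n + 1, ?_⟩
    simp only [runLaw, next, PMF.mem_support_bind_iff, PMF.support_map, mem_image]
    exact ⟨r, hn, _, ht, s, hs, rfl⟩

/-- The one-step disintegration of the measure on infinite runs, for measurable properties of
a prefix and its extension. -/
theorem runMeasure_succ (T : PTS S A) (σ : StrategyFun S A) (n : ℕ)
    {B : Set ((Π _ : Finset.Iic n, FinRun S A) × FinRun S A)} (hB : MeasurableSet B) :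
    T.runMeasure σ {ω | (Preorder.frestrictLe (π := fun _ => FinRun S A) n ω, ω (n + 1)) ∈ B} =
      ∫⁻ ω, (next σ (ω n)).toMeasure
        {r | (Preorder.frestrictLe (π := fun _ => FinRun S A) n ω, r) ∈ B} ∂T.runMeasure σ := by
  have h := Kernel.map_frestrictLe_trajMeasure_compProd_eq_map_trajMeasure
    (X := fun _ => FinRun S A) (μ₀ := Measure.dirac (FinRun.start T.init))
    (κ := nextKernel σ) (a := n)
  have hm : Measurable (Preorder.frestrictLe (π := fun _ => FinRun S A) n) := by fun_prop
  have h2 := congrArg (fun m => m B) h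
  rw [Measure.map_apply (by fun_prop) hB, Measure.compProd_apply hB,
    lintegral_map (Kernel.measurable_kernel_prodMk_left hB) hm] at h2
  exact h2.symm

theorem _root_.PMF.lintegral_toMeasure_eq_tsum {α : Type*} [MeasurableSpace α] [DiscreteMeasurableSpace α]
    (p : PMF α) (g : α → ℝ≥0∞) : ∫⁻ a, g a ∂p.toMeasure = ∑' a, p a * g a := by
  have h : p.toMeasure = Measure.sum fun a => p a • Measure.dirac a := by
    ext s hs
    rw [PMF.toMeasure_apply _ hs, Measure.sum_apply _ hs]
    refine tsum_congr fun a => ?_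
    by_cases ha : a ∈ s <;> simp [ha]
  rw [h, lintegral_sum_measure]
  exact tsum_congr fun a => by
    rw [lintegral_smul_measure, lintegral_dirac' _ Measurable.of_discrete, smul_eq_mul]

instance : DiscreteMeasurableSpace (FinRun S A) :=
  ⟨fun _ => MeasurableSpace.measurableSet_top⟩

theorem runMeasure_eval (T : PTS S A) (σ : StrategyFun S A) (n : ℕ) (B : Set (FinRun S A)) :
    T.runMeasure σ {ω | ω n ∈ B} = (T.runLaw σ n).toMeasure B := by
  have hB : ∀ B : Set (FinRun S A), MeasurableSet B := fun _ => .of_discrete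
  induction n generalizing B with
  | zero =>
    have h1 : (T.runMeasure σ).map (Preorder.frestrictLe (π := fun _ => FinRun S A) 0) =
        (Measure.dirac (FinRun.start T.init)).map
          (MeasurableEquiv.piUnique (fun _ : Finset.Iic 0 => FinRun S A)).symm := by
      rw [runMeasure, Kernel.trajMeasure, Measure.map_comp _ _ (by fun_prop),
        Kernel.traj_map_frestrictLe, Kernel.partialTraj_self, Measure.id_comp]
    have hZ : MeasurableSet {y : Finset.Iic 0 → FinRun S A |
        y ⟨0, Finset.mem_Iic.2 le_rfl⟩ ∈ B} := measurable_pi_apply _ (hB B)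
    have h2 := congrArg (fun m => m {y | y ⟨0, Finset.mem_Iic.2 le_rfl⟩ ∈ B}) h1
    rw [Measure.map_apply (by fun_prop) hZ, Measure.map_apply (MeasurableEquiv.measurable _) hZ]
      at h2
    rw [runLaw, PMF.toMeasure_pure]
    exact h2
  | succ n ih =>
    have h1 := T.runMeasure_succ σ n (B := Prod.snd ⁻¹' B) (measurable_snd (hB B))
    simp only [mem_preimage] at h1
    have hmap : (T.runMeasure σ).map (fun ω => ω n) = (T.runLaw σ n).toMeasure := by
      ext B _
      rw [Measure.map_apply (measurable_pi_apply n) (hB B), ← ih]; rfl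
    have hg : Measurable fun r : FinRun S A => (next σ r).toMeasure B := .of_discrete
    have h3 := lintegral_map (μ := T.runMeasure σ) hg (measurable_pi_apply n)
    rw [hmap] at h3
    refine h1.trans (h3.symm.trans ?_)
    rw [runLaw, PMF.toMeasure_bind_apply _ _ _ (hB B), PMF.lintegral_toMeasure_eq_tsum]

/-- Almost surely, consecutive entries of an infinite run are one-step extensions, so that the
finite run at time `n` records all the visits up to then. -/
theorem ae_visits_iff (T : PTS S A) (σ : StrategyFun S A) (F : Set S) (n : ℕ) :
    ∀ᵐ ω ∂T.runMeasure σ, (∃ i ≤ n, (ω i).last ∈ F) ↔ (ω n).Visits F := by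
  have hB : ∀ B : Set (FinRun S A), MeasurableSet B := fun _ => .of_discrete
  induction n with
  | zero =>
    have : T.runMeasure σ {ω | ω 0 ∈ ({FinRun.start T.init}ᶜ : Set (FinRun S A))} = 0 := by
      rw [runMeasure_eval, PMF.toMeasure_apply_eq_zero_iff _ (hB _)]
      simp [runLaw]
    filter_upwards [measure_eq_zero_iff_ae_notMem.1 this] with ω hω
    simp only [mem_compl_iff, mem_singleton_iff, not_not] at hω
    simp [hω, FinRun.Visits, FinRun.last]
  | succ n ih =>
    let B : Set ((Π _ : Finset.Iic n, FinRun S A) × FinRun S A) :=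
      {p | ¬ (p.2.Visits F ↔
        ((p.1 ⟨n, Finset.mem_Iic.2 le_rfl⟩).Visits F ∨ p.2.last ∈ F))}
    have h1 : Measurable fun p : (Π _ : Finset.Iic n, FinRun S A) × FinRun S A =>
        p.2.Visits F := (measurable_from_top (f := FinRun.Visits F)).comp measurable_snd
    have h2 : Measurable fun p : (Π _ : Finset.Iic n, FinRun S A) × FinRun S A =>
        (p.1 ⟨n, Finset.mem_Iic.2 le_rfl⟩).Visits F :=
      (measurable_from_top (f := FinRun.Visits F)).comp
        ((measurable_pi_apply _).comp measurable_fst)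
    have h3 : Measurable fun p : (Π _ : Finset.Iic n, FinRun S A) × FinRun S A =>
        p.2.last ∈ F :=
      (measurable_from_top (f := fun r : FinRun S A => r.last ∈ F)).comp measurable_snd
    have hBm : MeasurableSet B := measurableSet_setOfPred.2 (h1.iff (h2.or h3)).not
    have h0 := T.runMeasure_succ σ n hBm
    have hz : ∀ ω : ℕ → FinRun S A, (next σ (ω n)).toMeasure
        {r | (Preorder.frestrictLe (π := fun _ => FinRun S A) n ω, r) ∈ B} = 0 := by
      intro ω
      rw [PMF.toMeasure_apply_eq_zero_iff _ (hB _), Set.disjoint_left]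
      intro r hr
      obtain ⟨t, -, s, -, rfl⟩ := mem_support_next hr
      simp [B, FinRun.Visits, FinRun.last]
    simp only [hz, lintegral_zero] at h0
    filter_upwards [ih, measure_eq_zero_iff_ae_notMem.1 h0] with ω h4 h5
    simp only [B, mem_ofPred_eq, not_not, Preorder.frestrictLe_apply] at h5
    rw [h5, ← h4]
    simp only [Nat.le_succ_iff]
    constructor
    · rintro ⟨i, hi | rfl, h⟩
      exacts [Or.inl ⟨i, hi, h⟩, Or.inr h]
    · rintro (⟨i, hi, h⟩ | h)
      exacts [⟨i, Or.inl hi, h⟩, ⟨_, Or.inr rfl, h⟩]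

theorem probReach_eq_iSup (T : PTS S A) (σ : StrategyFun S A) (F : Set S) :
    T.probReach σ F = ⨆ n, (T.runLaw σ n).toMeasure {r | r.Visits F} := by
  have h1 : {ω : ℕ → FinRun S A | ∃ i, (ω i).last ∈ F} =
      ⋃ n, {ω | ∃ i ≤ n, (ω i).last ∈ F} := by
    ext ω
    simp only [mem_ofPred_eq, mem_iUnion]
    exact ⟨fun ⟨i, h⟩ => ⟨i, i, le_rfl, h⟩, fun ⟨_, i, _, h⟩ => ⟨i, h⟩⟩
  have h2 : Monotone fun n : ℕ => {ω : ℕ → FinRun S A | ∃ i ≤ n, (ω i).last ∈ F} :=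
    fun m n hmn ω ⟨i, hi, h⟩ => ⟨i, hi.trans hmn, h⟩
  rw [probReach, h1, h2.measure_iUnion]
  refine iSup_congr fun n => ?_
  rw [← runMeasure_eval]
  exact measure_congr ((T.ae_visits_iff σ F n).mono fun ω h => propext h)

end PTS

/-! ### Couplings of discrete distributions -/

namespace PMF

variable {α β : Type*}

theorem bind_congr_support {p : PMF α} {f g : α → PMF β} (h : ∀ a ∈ p.support, f a = g a) :
    p.bind f = p.bind g := by
  ext b
  simp only [PMF.bind_apply]
  refine tsum_congr fun a => ?_
  by_cases ha : p a = 0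
  · simp [ha]
  · rw [h a ha]

/-- Conditioning of a discrete joint distribution on its second component. -/
theorem exists_disintegration (J : PMF (α × β)) : ∃ κ : β → PMF α,
    (∀ b ∈ (J.map Prod.snd).support, ∀ a ∈ (κ b).support, (a, b) ∈ J.support) ∧
    (J.map Prod.snd).bind (fun b => (κ b).map fun a => (a, b)) = J := by
  classical
  have hsum : ∀ b, (J.map Prod.snd) b = ∑' a, J (a, b) := by
    intro b
    rw [PMF.map_apply, ENNReal.tsum_prod']
    refine tsum_congr fun a => ?_
    simp only
    rw [tsum_eq_single b]
    · simp
    · intro b' hb'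
      simp [hb'.symm]
  have key : ∀ b, ∃ q : PMF α, b ∈ (J.map Prod.snd).support →
      ∀ a, q a = J (a, b) * (∑' a, J (a, b))⁻¹ := by
    intro b
    by_cases hb : b ∈ (J.map Prod.snd).support
    · have h0 : (∑' a, J (a, b)) ≠ 0 := by rw [← hsum]; exact hb
      have h1 : (∑' a, J (a, b)) ≠ ⊤ := by rw [← hsum]; exact PMF.apply_ne_top _ _
      exact ⟨PMF.normalize (fun a => J (a, b)) h0 h1, fun _ a => PMF.normalize_apply _ _ _⟩
    · obtain ⟨p, -⟩ := J.support_nonempty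
      exact ⟨PMF.pure p.1, fun h => absurd h hb⟩
  choose κ hκ using key
  refine ⟨κ, fun b hb a ha => ?_, ?_⟩
  · rw [PMF.mem_support_iff, hκ b hb] at ha
    exact left_ne_zero_of_mul ha
  · ext ⟨a, b⟩
    rw [PMF.bind_apply, tsum_eq_single b]
    · rw [PMF.map_apply _ (κ b), tsum_eq_single a]
      · by_cases hb : b ∈ (J.map Prod.snd).support
        · have h0 : (∑' a, J (a, b)) ≠ 0 := by rw [← hsum]; exact hb
          have h1 : (∑' a, J (a, b)) ≠ ⊤ := by rw [← hsum]; exact PMF.apply_ne_top _ _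
          simp only [if_true]
          rw [hκ b hb, hsum, mul_comm, mul_assoc, ENNReal.inv_mul_cancel h0 h1, mul_one]
        · rw [PMF.mem_support_iff, not_not] at hb
          rw [hb, zero_mul]
          rw [hsum, ENNReal.tsum_eq_zero] at hb
          exact (hb a).symm
      · intro a' ha'
        simp [ha'.symm]
    · intro b' hb'
      rw [PMF.map_apply]
      simp [hb'.symm]

/-- If the mixture of the distributions `g t`, `t ∼ c`, is the image of `μ` under `f`, then a
draw `s ∼ μ` and a draw `t ∼ c` followed by a draw `s' ∼ g t` can be coupled with `s' = f s`. -/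
theorem exists_coupling {γ : Type*} (μ : PMF α) (f : α → β) (c : PMF γ) (g : γ → PMF β)
    (h : c.bind g = μ.map f) : ∃ J : PMF (α × γ × β),
      J.map Prod.fst = μ ∧ J.map Prod.snd = (c.bind fun t => (g t).map fun s' => (t, s')) ∧
      ∀ p ∈ J.support, p.2.2 = f p.1 := by
  let K : PMF (γ × β) := c.bind fun t => (g t).map fun s' => (t, s')
  have hK : K.map Prod.snd = μ.map f := by
    rw [← h]
    simp only [K, PMF.map_bind, PMF.map_comp, Function.comp_def]
    exact congrArg c.bind (funext fun t => PMF.map_id (g t))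
  obtain ⟨κ, -, hκ⟩ := K.exists_disintegration
  refine ⟨μ.bind fun s => (κ (f s)).map fun t => (s, t, f s), ?_, ?_, ?_⟩
  · simp only [PMF.map_bind, PMF.map_comp, Function.comp_def]
    exact (congrArg μ.bind (funext fun s => PMF.map_const (κ (f s)) s)).trans μ.bind_pure
  · change _ = K
    rw [← hκ, hK]
    simp [PMF.map_bind, PMF.map_comp, Function.comp_def, PMF.bind_map]
  · intro p hp
    simp only [PMF.mem_support_bind_iff, PMF.support_map, mem_image] at hp
    obtain ⟨s, -, t, -, rfl⟩ := hp
    rfl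

end PMF

/-! ### Strategies along a probabilistic simulation -/

namespace PTS

variable {S A S' A' : Type*}

/-- The joint law of the first `n` transitions of two runs, where the second one follows the first
one: the first chooses a transition `t` according to `σ`, and `C t` then gives jointly the target
of `t`, a transition of the second system, and the target of that transition. -/
def coupledLaw (T : PTS S A) (T' : PTS S' A') (σ : StrategyFun S A)
    (C : S × A × PMF S → PMF (S × (S' × A' × PMF S') × S')) :
    ℕ → PMF (FinRun S A × FinRun S' A')
  | 0 => PMF.pure (FinRun.start T.init, FinRun.start T'.init)
  | n + 1 => (coupledLaw T T' σ C n).bind fun p => (σ p.1).bind fun t => (C t).map fun q =>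
      (p.1.step t.2.1 t.2.2 q.1, p.2.step q.2.1.2.1 q.2.1.2.2 q.2.2)

/-- What the two components of a coupled pair of runs have in common. -/
structure Related (T : PTS S A) (σ : StrategyFun S A) (D E : Set (S × A × PMF S))
    (D' E' : Set (S' × A' × PMF S')) (f : S → S') (F' : Set S') (n : ℕ)
    (r : FinRun S A) (r' : FinRun S' A') : Prop where
  gen : T.Generated σ r
  length : r'.length = n
  last : r'.last = f r.last
  visits : r'.Visits F' ↔ r.Visits (f ⁻¹' F')
  kind : ∀ r₀' a' μ' s', r' = FinRun.step r₀' a' μ' s' → ∃ r₀ a μ s, r = FinRun.step r₀ a μ s ∧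
    ((r₀.last, a, μ) ∈ D → (r₀'.last, a', μ') ∈ D') ∧
    ((r₀.last, a, μ) ∈ E → (r₀'.last, a', μ') ∈ E')

/-- If every transition of `T` is matched, from the image of its source under `f` and within the
same kind (`D` or `E`), by a randomized choice of transitions of `T'` that has the image of its
target distribution, then every alternating strategy of `T` is imitated by one of `T'`.

The imitating strategy sees only the run of `T'`; it draws a run of `T` from the conditional law
given that run, and then does what the matching prescribes there. -/
theorem exists_strategy_of_simulation (T : PTS S A) (T' : PTS S' A')
    {D E : Set (S × A × PMF S)} {D' E' : Set (S' × A' × PMF S')}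
    (hT : T.trans = D ∪ E) (hT' : T'.trans = D' ∪ E') (hDE : Disjoint D E)
    (hDE' : Disjoint D' E') (f : S → S') (hinit : f T.init = T'.init)
    (hD : ∀ t ∈ D, ∃ c : PMF (S' × A' × PMF S'),
      (∀ t' ∈ c.support, t' ∈ D' ∧ t'.1 = f t.1) ∧ c.bind (fun t' => t'.2.2) = t.2.2.map f)
    (hE : ∀ t ∈ E, ∃ c : PMF (S' × A' × PMF S'),
      (∀ t' ∈ c.support, t' ∈ E' ∧ t'.1 = f t.1) ∧ c.bind (fun t' => t'.2.2) = t.2.2.map f)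
    {σ : StrategyFun S A} (hσ : T.IsStrategy σ) (hσa : T.Alternates D E σ) (F' : Set S') :
    ∃ σ' : StrategyFun S' A', T'.IsStrategy σ' ∧ T'.Alternates D' E' σ' ∧
      T'.probReach σ' F' = T.probReach σ (f ⁻¹' F') := by
  have hmatch : ∀ t ∈ T.trans, ∃ c : PMF (S' × A' × PMF S'),
      (∀ t' ∈ c.support, t'.1 = f t.1 ∧ (t ∈ D → t' ∈ D') ∧ (t ∈ E → t' ∈ E')) ∧
      c.bind (fun t' => t'.2.2) = t.2.2.map f := by
    intro t ht
    rw [hT] at ht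
    rcases ht with ht | ht
    · obtain ⟨c, h1, h2⟩ := hD t ht
      exact ⟨c, fun t' h => ⟨(h1 t' h).2, fun _ => (h1 t' h).1,
        fun h' => (Set.disjoint_left.1 hDE ht h').elim⟩, h2⟩
    · obtain ⟨c, h1, h2⟩ := hE t ht
      exact ⟨c, fun t' h => ⟨(h1 t' h).2, fun h' => (Set.disjoint_left.1 hDE h' ht).elim,
        fun _ => (h1 t' h).1⟩, h2⟩
  have hcoup : ∀ t, ∃ (c : PMF (S' × A' × PMF S')) (C : PMF (S × (S' × A' × PMF S') × S')),
      t ∈ T.trans → (∀ t' ∈ c.support, t'.1 = f t.1 ∧ (t ∈ D → t' ∈ D') ∧ (t ∈ E → t' ∈ E')) ∧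
        C.map Prod.fst = t.2.2 ∧
        C.map Prod.snd = (c.bind fun t' => t'.2.2.map fun s' => (t', s')) ∧
        ∀ p ∈ C.support, p.2.2 = f p.1 := by
    have hpos : ∀ t ∈ T.trans, ∃ (c : PMF (S' × A' × PMF S'))
        (C : PMF (S × (S' × A' × PMF S') × S')),
        (∀ t' ∈ c.support, t'.1 = f t.1 ∧ (t ∈ D → t' ∈ D') ∧ (t ∈ E → t' ∈ E')) ∧
        C.map Prod.fst = t.2.2 ∧
        C.map Prod.snd = (c.bind fun t' => t'.2.2.map fun s' => (t', s')) ∧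
        ∀ p ∈ C.support, p.2.2 = f p.1 := by
      intro t ht
      obtain ⟨c, h1, h2⟩ := hmatch t ht
      obtain ⟨C, h3, h4, h5⟩ := PMF.exists_coupling t.2.2 f c _ h2
      exact ⟨c, C, h1, h3, h4, h5⟩
    intro t
    by_cases ht : t ∈ T.trans
    · obtain ⟨c, C, h⟩ := hpos t ht
      exact ⟨c, C, fun _ => h⟩
    · -- outside the transitions any value will do; the first choice of `σ` shows that one exists
      obtain ⟨t₀, ht₀⟩ := (σ (FinRun.start T.init)).support_nonempty
      obtain ⟨c, C, -⟩ := hpos t₀ (hσ _ Generated.start _ ht₀).1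
      exact ⟨c, C, fun h => absurd h ht⟩
  choose c C hC using hcoup
  let J := coupledLaw T T' σ C
  have hJ : ∀ n, ∀ p ∈ (J n).support, Related T σ D E D' E' f F' n p.1 p.2 := by
    intro n
    induction n with
    | zero =>
      intro p hp
      obtain rfl : p = (FinRun.start T.init, FinRun.start T'.init) := by
        simpa [J, coupledLaw] using hp
      refine ⟨Generated.start, rfl, hinit.symm, ?_, fun _ _ _ _ h => by simp at h⟩
      simp [FinRun.Visits, hinit]
    | succ n ih =>
      intro p hp
      simp only [J, coupledLaw, PMF.mem_support_bind_iff, PMF.support_map, mem_image] at hp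
      obtain ⟨⟨r, r'⟩, hr, ⟨s, a, μ⟩, ht, ⟨s₁, ⟨s', a', μ'⟩, s₁'⟩, hq, rfl⟩ := hp
      have hrel := ih _ hr
      obtain ⟨htT, hs⟩ := hσ _ hrel.gen _ ht
      obtain ⟨h1, h2, h3, h4⟩ := hC _ htT
      obtain rfl : s₁' = f s₁ := h4 _ hq
      have hs₁ : s₁ ∈ μ.support := by
        rw [← show (C (s, a, μ)).map Prod.fst = μ from h2, PMF.support_map]
        exact ⟨_, hq, rfl⟩
      have hc : (s', a', μ') ∈ (c (s, a, μ)).support := by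
        have : ((s', a', μ'), f s₁) ∈ ((C (s, a, μ)).map Prod.snd).support := by
          rw [PMF.support_map]
          exact ⟨_, hq, rfl⟩
        rw [h3] at this
        simp only [PMF.mem_support_bind_iff, PMF.support_map, mem_image, Prod.mk.injEq] at this
        obtain ⟨t', ht', s'', -, rfl, -⟩ := this
        exact ht'
      obtain ⟨h5, h6, h7⟩ := h1 _ hc
      simp only at hs h5 h6 h7
      subst hs
      refine ⟨Generated.step hrel.gen ht hs₁, by simp [FinRun.length, hrel.length], rfl, ?_, ?_⟩
      · have := hrel.visits
        simp only at this
        simp only [FinRun.Visits, this, mem_preimage]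
      · intro r₀' a₀' μ₀' s₀' h
        simp only [FinRun.step.injEq] at h
        obtain ⟨rfl, rfl, rfl, rfl⟩ := h
        refine ⟨_, _, _, _, rfl, ?_⟩
        rw [show r'.last = s' from hrel.last.trans h5.symm]
        exact ⟨h6, h7⟩
  choose κ hκs hκ using fun n => (J n).exists_disintegration
  let σ' : StrategyFun S' A' := fun r' => (κ r'.length r').bind fun r => (σ r).bind c
  have hlaw : ∀ n, T'.runLaw σ' n = (J n).map Prod.snd := by
    intro n
    induction n with
    | zero => simp [runLaw, J, coupledLaw, PMF.pure_map]
    | succ n ih =>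
      let G : FinRun S A → FinRun S' A' → PMF (FinRun S' A') := fun r r' =>
        (σ r).bind fun t => (c t).bind fun t' => t'.2.2.map fun s' => r'.step t'.2.1 t'.2.2 s'
      have h1 : (J (n + 1)).map Prod.snd = (J n).bind fun p => G p.1 p.2 := by
        simp only [J, coupledLaw, PMF.map_bind]
        refine PMF.bind_congr_support fun p hp => PMF.bind_congr_support fun t ht => ?_
        have h3 := (hC t (hσ _ (hJ n p hp).gen _ ht).1).2.2.1
        have h4 := congrArg (PMF.map fun q : (S' × A' × PMF S') × S' =>
          p.2.step q.1.2.1 q.1.2.2 q.2) h3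
        simpa only [PMF.map_comp, PMF.map_bind, Function.comp_def] using h4
      have h2 : ((J n).bind fun p => G p.1 p.2) =
          ((J n).map Prod.snd).bind fun r' => (κ n r').bind fun r => G r r' := by
        conv_lhs => rw [← hκ n]
        simp only [PMF.bind_bind, PMF.bind_map, Function.comp_def]
      rw [runLaw, ih, h1, h2]
      refine PMF.bind_congr_support fun r' hr' => ?_
      rw [PMF.support_map] at hr'
      obtain ⟨p, hp, rfl⟩ := hr'
      simp only [next, σ', (hJ n p hp).length, PMF.bind_bind, G]
  have hgen : ∀ r', T'.Generated σ' r' → ∀ t' ∈ (σ' r').support, ∃ n r, (r, r') ∈ (J n).support ∧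
      ∃ t ∈ (σ r).support, t' ∈ (c t).support := by
    intro r' hr' t' ht'
    obtain ⟨n, hn⟩ := exists_mem_support_runLaw_of_generated hr'
    rw [hlaw] at hn
    have hl : r'.length = n := by
      rw [PMF.support_map] at hn
      obtain ⟨p, hp, rfl⟩ := hn
      exact (hJ n p hp).length
    simp only [σ', PMF.mem_support_bind_iff, hl] at ht'
    obtain ⟨r, hr, t, ht, htc⟩ := ht'
    exact ⟨n, r, hκs n r' hn r hr, t, ht, htc⟩
  have hstrat : T'.IsStrategy σ' := by
    intro r' hr' t' ht'
    obtain ⟨n, r, hr, t, ht, htc⟩ := hgen r' hr' t' ht'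
    have hrel := hJ n _ hr
    obtain ⟨htT, htl⟩ := hσ _ hrel.gen _ ht
    obtain ⟨h5, h6, h7⟩ := (hC t htT).1 _ htc
    refine ⟨?_, by rw [h5, htl]; exact hrel.last.symm⟩
    rw [hT] at htT
    rw [hT']
    exact htT.imp h6 h7
  refine ⟨σ', hstrat, ?_, ?_⟩
  · intro r₀' a' μ' s' hg
    have hkind : (r₀'.last, a', μ') ∈ D' ∨ (r₀'.last, a', μ') ∈ E' := by
      cases hg with
      | step h1 h2 h3 => simpa [hT'] using (hstrat _ h1 _ h2).1
    rcases hkind with hk | hk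
    · refine Or.inl ⟨hk, fun t' ht' => ?_⟩
      obtain ⟨n, r, hr, t, ht, htc⟩ := hgen _ hg t' ht'
      have hrel := hJ n _ hr
      obtain ⟨-, -, h7⟩ := (hC t (hσ _ hrel.gen _ ht).1).1 _ htc
      obtain ⟨r₀, a, μ, s, rfl, -, hEE⟩ := hrel.kind _ _ _ _ rfl
      rcases hσa _ _ _ _ hrel.gen with ⟨-, h⟩ | ⟨h, -⟩
      · exact h7 (h ht)
      · exact (Set.disjoint_left.1 hDE' hk (hEE h)).elim
    · refine Or.inr ⟨hk, fun t' ht' => ?_⟩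
      obtain ⟨n, r, hr, t, ht, htc⟩ := hgen _ hg t' ht'
      have hrel := hJ n _ hr
      obtain ⟨-, h6, -⟩ := (hC t (hσ _ hrel.gen _ ht).1).1 _ htc
      obtain ⟨r₀, a, μ, s, rfl, hDD, -⟩ := hrel.kind _ _ _ _ rfl
      rcases hσa _ _ _ _ hrel.gen with ⟨h, -⟩ | ⟨-, h⟩
      · exact (Set.disjoint_left.1 hDE' (hDD h) hk).elim
      · exact h6 (h ht)
  · have hfst : ∀ n, T.runLaw σ n = (J n).map Prod.fst := by
      intro n
      induction n with
      | zero => simp [runLaw, J, coupledLaw, PMF.pure_map]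
      | succ n ih =>
        simp only [runLaw, ih, J, coupledLaw, PMF.map_bind, PMF.bind_map]
        refine PMF.bind_congr_support fun p hp => PMF.bind_congr_support fun t ht => ?_
        have h2 := (hC t (hσ _ (hJ n p hp).gen _ ht).1).2.1
        have h4 := congrArg (PMF.map fun s => p.1.step t.2.1 t.2.2 s) h2
        simpa only [PMF.map_comp, Function.comp_def] using h4.symm
    rw [probReach_eq_iSup, probReach_eq_iSup]
    refine iSup_congr fun n => ?_
    let _ : MeasurableSpace (FinRun S A × FinRun S' A') := ⊤
    rw [hlaw, hfst, PMF.toMeasure_map_apply _ _ _ measurable_from_top .of_discrete,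
      PMF.toMeasure_map_apply _ _ _ measurable_from_top .of_discrete]
    refine PMF.toMeasure_apply_eq_of_inter_support_eq _ trivial trivial ?_
    ext p
    simp only [mem_inter_iff, mem_preimage, mem_ofPred_eq, and_congr_left_iff]
    exact fun hp => (hJ n p hp).visits

end PTS

/-! ### Regions as classes of valuations -/

namespace Region

variable {X : Type*} {M k : ℕ}

/-- Two valuations have the same integer parts of `k * v x`, the same clocks with zero fractional
part and the same order of the fractional parts; these are the valuations that no `k`-region
separates. -/
structure Equiv (k : ℕ) (v w : Val X) : Prop where
  floor_eq : ∀ x, ⌊(k : ℝ) * v x⌋ = ⌊(k : ℝ) * w x⌋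
  fract_zero : ∀ x, Int.fract ((k : ℝ) * v x) = 0 ↔ Int.fract ((k : ℝ) * w x) = 0
  fract_le : ∀ x y, Int.fract ((k : ℝ) * v x) ≤ Int.fract ((k : ℝ) * v y) ↔
    Int.fract ((k : ℝ) * w x) ≤ Int.fract ((k : ℝ) * w y)

theorem mem_iff (hk : 0 < k) {R : Region X M k} {v : Val X} : R.Mem v ↔
    (∀ x, ⌊(k : ℝ) * v x⌋ = (R.num x : ℤ)) ∧
    (∀ x, Int.fract ((k : ℝ) * v x) = 0 ↔ R.block x = 0) ∧
    ∀ x y, Int.fract ((k : ℝ) * v x) ≤ Int.fract ((k : ℝ) * v y) ↔ R.block x ≤ R.block y := by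
  refine and_congr_right fun h1 => and_congr_left fun _ => forall_congr' fun x => ?_
  have hk' : (k : ℝ) ≠ 0 := by positivity
  have : v x = R.h x ↔ Int.fract ((k : ℝ) * v x) = 0 := by
    rw [Int.fract, h1 x, sub_eq_zero, ← NNReal.coe_inj, h]
    push_cast
    rw [eq_div_iff hk', mul_comm]
  rw [this]

theorem Mem.equiv (hk : 0 < k) {R : Region X M k} {v w : Val X} (hv : R.Mem v) (hw : R.Mem w) :
    Equiv k v w := by
  rw [mem_iff hk] at hv hw
  exact ⟨fun x => (hv.1 x).trans (hw.1 x).symm, fun x => (hv.2.1 x).trans (hw.2.1 x).symm,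
    fun x y => (hv.2.2 x y).trans (hw.2.2 x y).symm⟩

theorem Mem.of_equiv (hk : 0 < k) {R : Region X M k} {v w : Val X} (hv : R.Mem v)
    (h : Equiv k v w) : R.Mem w := by
  rw [mem_iff hk] at hv ⊢
  exact ⟨fun x => (h.1 x).symm.trans (hv.1 x), fun x => (h.2 x).symm.trans (hv.2.1 x),
    fun x y => (h.3 x y).symm.trans (hv.2.2 x y)⟩

/-- The blocks are numbered without gaps, so a region has only one description. -/
theorem eq_of_mem (hk : 0 < k) {R R' : Region X M k} {v : Val X} (hv : R.Mem v)
    (hv' : R'.Mem v) : R = R' := by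
  rw [mem_iff hk] at hv hv'
  have hle : ∀ x y, R.block x ≤ R.block y ↔ R'.block x ≤ R'.block y := fun x y =>
    (hv.2.2 x y).symm.trans (hv'.2.2 x y)
  have h0 : ∀ x, R.block x = 0 ↔ R'.block x = 0 := fun x =>
    (hv.2.1 x).symm.trans (hv'.2.1 x)
  have key : ∀ (R R' : Region X M k), (∀ x y, R.block x ≤ R.block y ↔ R'.block x ≤ R'.block y) →
      (∀ x, R.block x = 0 ↔ R'.block x = 0) → ∀ m x, R.block x = m → m ≤ R'.block x := by
    intro R R' hle h0 m
    induction m with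
    | zero => exact fun _ _ => Nat.zero_le _
    | succ m ih =>
      intro x hx
      rcases Nat.eq_zero_or_pos m with rfl | hm
      · exact Nat.one_le_iff_ne_zero.2 fun h => by simp [(h0 x).2 h] at hx
      · obtain ⟨y, hy⟩ := R.block_nonempty m hm (by have := R.block_le x; omega)
        have h1 := ih y hy
        have h2 := hle x y
        omega
  have hb : R.block = R'.block := funext fun x =>
    le_antisymm (key R R' hle h0 _ x rfl)
      (key R' R (fun x y => (hle x y).symm) (fun x => (h0 x).symm) _ x rfl)
  have hn : ∀ (R R' : Region X M k), R.block = R'.block → R.n ≤ R'.n := by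
    intro R R' h
    rcases Nat.eq_zero_or_pos R.n with hz | hz
    · omega
    · obtain ⟨x, hx⟩ := R.block_nonempty R.n hz le_rfl
      rw [← hx, h]
      exact R'.block_le x
  refine Region.ext (le_antisymm (hn R R' hb) (hn R' R hb.symm)) (funext fun x => ?_) hb
  exact_mod_cast (hv.1 x).symm.trans (hv'.1 x)

/-- The block of a clock is the number of distinct non-zero fractional parts up to its own. -/
theorem exists_mem [Fintype X] {v : Val X} (hk : 0 < k) (hv : ∀ x, v x ≤ M) :
    ∃ R : Region X M k, R.Mem v := by
  classical
  let φ : X → ℝ := fun x => Int.fract ((k : ℝ) * v x)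
  have hφ : ∀ x, 0 ≤ φ x := fun x => Int.fract_nonneg _
  let G : Finset ℝ := (Finset.univ.image φ).filter (0 < ·)
  have hG : ∀ g, g ∈ G ↔ (∃ x, φ x = g) ∧ 0 < g := by simp [G]
  let b : X → ℕ := fun x => (G.filter (· ≤ φ x)).card
  have hle : ∀ x y, φ x ≤ φ y ↔ b x ≤ b y := by
    intro x y
    refine ⟨fun h => Finset.card_le_card fun g hg => ?_, fun h => ?_⟩
    · simp only [Finset.mem_filter] at hg ⊢
      exact ⟨hg.1, hg.2.trans h⟩
    · by_contra! hlt
      refine absurd h (not_le.2 (Finset.card_lt_card ?_))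
      refine ⟨fun g hg => ?_, fun hsub => ?_⟩
      · simp only [Finset.mem_filter] at hg ⊢
        exact ⟨hg.1, hg.2.trans hlt.le⟩
      · have := hsub (Finset.mem_filter.2 ⟨(hG (φ x)).2 ⟨⟨x, rfl⟩, (hφ y).trans_lt hlt⟩, le_rfl⟩)
        exact absurd (Finset.mem_filter.1 this).2 (not_le.2 hlt)
  have h0 : ∀ x, φ x = 0 ↔ b x = 0 := by
    intro x
    rw [Finset.card_eq_zero, Finset.filter_eq_empty_iff]
    constructor
    · intro h g hg
      rw [h, not_le]
      exact ((hG g).1 hg).2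
    · intro h
      by_contra hne
      exact h ((hG _).2 ⟨⟨x, rfl⟩, lt_of_le_of_ne (hφ x) (Ne.symm hne)⟩) le_rfl
  have hfl : ∀ x, ⌊(k : ℝ) * v x⌋ = ((⌊(k : ℝ) * v x⌋₊ : ℕ) : ℤ) := fun x =>
    (Int.natCast_floor_eq_floor (by positivity)).symm
  have hvM : ∀ x, (v x : ℝ) ≤ M := fun x => by exact_mod_cast hv x
  refine ⟨⟨G.card, fun x => ⌊(k : ℝ) * v x⌋₊, b, fun x => ?_, fun x => ?_, fun i h1 hi => ?_,
    fun x hx => ?_⟩, (mem_iff hk).2 ⟨hfl, h0, hle⟩⟩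
  · refine Nat.floor_le_of_le ?_
    push_cast
    nlinarith [hvM x, (Nat.cast_pos (α := ℝ)).2 hk]
  · exact Finset.card_le_card (Finset.filter_subset _ _)
  · let e := G.orderEmbOfFin rfl
    have hlt : i - 1 < G.card := by omega
    obtain ⟨⟨x, hx⟩, -⟩ := (hG _).1 (G.orderEmbOfFin_mem rfl ⟨i - 1, hlt⟩)
    refine ⟨x, ?_⟩
    have : G.filter (· ≤ φ x) = (Finset.Iic (⟨i - 1, hlt⟩ : Fin G.card)).map e.toEmbedding := by
      ext g
      simp only [Finset.mem_filter, Finset.mem_map, Finset.mem_Iic]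
      constructor
      · rintro ⟨hg, hgx⟩
        rw [← Finset.mem_coe, ← G.range_orderEmbOfFin rfl] at hg
        obtain ⟨j, rfl⟩ := hg
        rw [hx] at hgx
        exact ⟨j, e.le_iff_le.1 hgx, rfl⟩
      · rintro ⟨j, hj, rfl⟩
        exact ⟨G.orderEmbOfFin_mem rfl j, by rw [hx]; exact e.le_iff_le.2 hj⟩
    change (G.filter (· ≤ φ x)).card = i
    rw [this, Finset.card_map, Fin.card_Iic]
    simp only
    omega
  · refine (h0 x).1 ?_
    have h1 := hfl x
    rw [hx] at h1
    have h2 : (k : ℝ) * v x ≤ ((M * k : ℕ) : ℝ) := by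
      push_cast
      nlinarith [hvM x, (Nat.cast_pos (α := ℝ)).2 hk]
    have h3 := Int.floor_le ((k : ℝ) * v x)
    rw [h1] at h3
    change Int.fract _ = 0
    rw [Int.fract, h1]
    push_cast at h2 h3 ⊢
    linarith

theorem mem_of_eq_add (hk : 0 < k) {R : Region X M k} {v : Val X} {φ : X → ℝ}
    (hv : ∀ x, (k : ℝ) * v x = R.num x + φ x) (hφ : ∀ x, φ x ∈ Ico (0 : ℝ) 1)
    (h0 : ∀ x, φ x = 0 ↔ R.block x = 0) (hle : ∀ x y, φ x ≤ φ y ↔ R.block x ≤ R.block y) :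
    R.Mem v := by
  have h1 : ∀ x, (k : ℝ) * v x = ((R.num x : ℤ) : ℝ) + φ x := fun x => by
    rw [hv x, Int.cast_natCast]
  have h2 : ∀ x, Int.fract ((k : ℝ) * v x) = φ x := fun x => by
    rw [h1, Int.fract_intCast_add, Int.fract_eq_self.2 (hφ x)]
  rw [mem_iff hk]
  simp only [h2]
  exact ⟨fun x => by rw [h1, Int.floor_intCast_add, Int.floor_eq_zero_iff.2 (hφ x), add_zero],
    h0, hle⟩

/-- A point of the region: the fractional part of `k * v x` is `i / (n + 1)` in the block `i`. -/
theorem nonempty (hk : 0 < k) (R : Region X M k) : ∃ v, R.Mem v := by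
  have hk' : (k : ℝ) ≠ 0 := by positivity
  have hn : (0 : ℝ) < R.n + 1 := by positivity
  refine ⟨fun x => (R.num x + (R.block x : ℝ≥0) / (R.n + 1)) / k,
    mem_of_eq_add hk (φ := fun x => (R.block x : ℝ) / (R.n + 1)) (fun x => ?_)
      (fun x => ⟨by positivity, ?_⟩) (fun x => ?_) (fun x y => ?_)⟩
  · push_cast
    field_simp
  · rw [div_lt_one hn]
    exact_mod_cast Nat.lt_succ_of_le (R.block_le x)
  · rw [div_eq_zero_iff]
    simp [hn.ne']
  · rw [div_le_div_iff_of_pos_right hn]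
    norm_cast

theorem Mem.le (hk : 0 < k) {R : Region X M k} {v : Val X} (hv : R.Mem v) (x : X) : v x ≤ M := by
  have hk' : (0 : ℝ) < k := by positivity
  have hv' := (mem_iff hk).1 hv
  have h1 := Int.floor_add_fract ((k : ℝ) * v x)
  rw [hv'.1 x] at h1
  have h2 := Int.fract_lt_one ((k : ℝ) * v x)
  have h3 : (k : ℝ) * v x ≤ M * k := by
    rcases eq_or_lt_of_le (R.num_le x) with h | h
    · rw [(hv'.2.1 x).2 (R.block_top x h), h] at h1
      push_cast at h1
      linarith
    · have : ((R.num x : ℝ) + 1) ≤ M * k := by exact_mod_cast h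
      push_cast at h1
      linarith
  have h4 : (v x : ℝ) ≤ M := by nlinarith
  exact_mod_cast h4

/-! ### Constraints, resets and refinement -/

theorem Equiv.sat (hk : 0 < k) {v w : Val X} (h : Equiv k v w) {ψ : ClockConstraint X}
    (hv : v.Sat ψ) : w.Sat ψ := by
  have hk' : (0 : ℝ) < k := by positivity
  have hlt : ∀ (u : Val X) x (c : ℕ), u x < c ↔ ⌊(k : ℝ) * u x⌋ < (k * c : ℕ) := by
    intro u x c
    rw [Int.floor_lt, ← NNReal.coe_lt_coe]
    push_cast
    exact (mul_lt_mul_iff_right₀ hk').symm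
  have hle : ∀ (u : Val X) x (c : ℕ), u x ≤ c ↔ ⌊(k : ℝ) * u x⌋ < (k * c : ℕ) ∨
      ⌊(k : ℝ) * u x⌋ = (k * c : ℕ) ∧ Int.fract ((k : ℝ) * u x) = 0 := by
    intro u x c
    rw [le_iff_lt_or_eq, hlt]
    refine or_congr_right ?_
    rw [← NNReal.coe_inj, ← mul_right_inj' hk'.ne']
    constructor
    · intro he
      rw [he]
      have : (k : ℝ) * ((c : ℝ≥0) : ℝ) = ((k * c : ℕ) : ℤ) := by push_cast; rfl
      rw [this]
      exact ⟨Int.floor_intCast _, Int.fract_intCast _⟩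
    · rintro ⟨h1, h2⟩
      rw [← Int.floor_add_fract ((k : ℝ) * u x), h1, h2]
      push_cast
      ring
  have hlt' : ∀ x (c : ℕ), v x < c ↔ w x < c := fun x c => by
    rw [hlt, hlt, h.floor_eq]
  have hle' : ∀ x (c : ℕ), v x ≤ c ↔ w x ≤ c := fun x c => by
    rw [hle, hle, h.floor_eq, h.fract_zero]
  intro a ha
  have h1 := hv a ha
  rcases hc : a.cmp <;> rw [hc] at h1 <;> simp only [Cmp.holds] at h1 ⊢
  · exact (hlt' _ _).1 h1
  · exact (hle' _ _).1 h1
  · exact not_lt.1 fun h2 => absurd h1 (not_le.2 ((hlt' _ _).2 h2))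
  · exact not_le.1 fun h2 => absurd h1 (not_lt.2 ((hle' _ _).2 h2))

theorem Mem.sat (hk : 0 < k) {R : Region X M k} {v : Val X} (hv : R.Mem v)
    {ψ : ClockConstraint X} (h : v.Sat ψ) : R.Sat ψ := fun _ hw => (hv.equiv hk hw).sat hk h

theorem Equiv.reset [DecidableEq X] {v w : Val X} (h : Equiv k v w) (Y : Finset X) :
    Equiv k (v.reset Y) (w.reset Y) := by
  refine ⟨fun x => ?_, fun x => ?_, fun x y => ?_⟩
  · by_cases hx : x ∈ Y <;> simp [Val.reset, hx, h.floor_eq]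
  · by_cases hx : x ∈ Y <;> simp [Val.reset, hx, h.fract_zero]
  · by_cases hx : x ∈ Y <;> by_cases hy : y ∈ Y <;> simp [Val.reset, hx, hy, h.fract_le]
    rw [(Int.fract_nonneg _).ge_iff_eq', (Int.fract_nonneg _).ge_iff_eq', h.fract_zero]

theorem isReset_iff [DecidableEq X] (hk : 0 < k) {R R' : Region X M k} {v : Val X}
    (hv : R.Mem v) (Y : Finset X) : R.IsReset Y R' ↔ R'.Mem (v.reset Y) :=
  ⟨fun h => h v hv, fun h _ hw => h.of_equiv hk ((hv.equiv hk hw).reset Y)⟩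

/-- Doubling the granularity refines the regions. -/
theorem Equiv.of_two_mul {v w : Val X} (h : Equiv (2 * k) v w) : Equiv k v w := by
  have hfl : ∀ x : ℝ, ⌊x⌋ = ⌊2 * x⌋ / 2 := fun x => by
    have h1 : 2 * ⌊x⌋ ≤ ⌊2 * x⌋ := Int.le_floor.2 (by
      push_cast
      linarith [Int.floor_le x])
    have h2 : ⌊2 * x⌋ < 2 * ⌊x⌋ + 2 := Int.floor_lt.2 (by
      push_cast
      linarith [Int.lt_floor_add_one x])
    omega
  have hfr : ∀ x : ℝ, Int.fract x = (Int.fract (2 * x) + (⌊2 * x⌋ % 2 : ℤ)) / 2 := fun x => by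
    have h1 := Int.floor_add_fract x
    have h2 := Int.floor_add_fract (2 * x)
    have h3 : ((⌊2 * x⌋ % 2 : ℤ) : ℝ) = ⌊2 * x⌋ - 2 * ⌊x⌋ := by
      rw [hfl x]
      have h4 : (⌊2 * x⌋ % 2) = ⌊2 * x⌋ - 2 * (⌊2 * x⌋ / 2) := by omega
      exact_mod_cast h4
    rw [h3]
    linarith
  have hcast : ∀ u : Val X, ∀ x, ((2 * k : ℕ) : ℝ) * u x = 2 * ((k : ℝ) * u x) := by
    intro u x; push_cast; ring
  obtain ⟨h1, h2, h3⟩ := h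
  simp only [hcast] at h1 h2 h3
  have hbit : ∀ x : ℝ, (⌊x⌋ % 2 = 0) ∨ (⌊x⌋ % 2 = 1) := fun x => Int.emod_two_eq_zero_or_one _
  refine ⟨fun x => by rw [hfl (_ * v x), hfl (_ * w x), h1], fun x => ?_, fun x y => ?_⟩
  · have e2 := h2 x
    have p := Int.fract_nonneg (2 * ((k : ℝ) * v x))
    have q := Int.fract_nonneg (2 * ((k : ℝ) * w x))
    rw [hfr (_ * v x), hfr (_ * w x), h1]
    rcases hbit (2 * ((k : ℝ) * w x)) with e | e <;> rw [e] <;> push_cast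
    · simpa using e2
    · constructor <;> intro _ <;> linarith
  · have e3 := h3 x y
    have p1 := Int.fract_nonneg (2 * ((k : ℝ) * v x))
    have q1 := Int.fract_nonneg (2 * ((k : ℝ) * w x))
    have p2 := Int.fract_nonneg (2 * ((k : ℝ) * v y))
    have q2 := Int.fract_nonneg (2 * ((k : ℝ) * w y))
    have p3 := Int.fract_lt_one (2 * ((k : ℝ) * v x))
    have q3 := Int.fract_lt_one (2 * ((k : ℝ) * w x))
    have p4 := Int.fract_lt_one (2 * ((k : ℝ) * v y))
    have q4 := Int.fract_lt_one (2 * ((k : ℝ) * w y))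
    rw [hfr (_ * v x), hfr (_ * w x), hfr (_ * v y), hfr (_ * w y), h1, h1,
      div_le_div_iff_of_pos_right two_pos, div_le_div_iff_of_pos_right two_pos]
    rcases hbit (2 * ((k : ℝ) * w x)) with e | e <;>
      rcases hbit (2 * ((k : ℝ) * w y)) with e' | e' <;> rw [e, e'] <;> push_cast
    · simpa using e3
    · constructor <;> intro _ <;> linarith
    · constructor <;> intro _ <;> linarith
    · simpa using e3

variable (M k) in
open Classical in
/-- The `k`-region that contains `v`, with the region of the zero valuation as the value where
there is none because a clock exceeds `M`. -/
def of (v : Val X) : Region X M k :=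
  if h : ∃ R : Region X M k, R.Mem v then h.choose else zero X M k

theorem mem_of [Fintype X] (hk : 0 < k) {v : Val X} (hv : ∀ x, v x ≤ M) : (of M k v).Mem v := by
  have h := exists_mem (k := k) hk hv
  rw [of, dif_pos h]
  exact h.choose_spec

theorem Mem.of_eq [Fintype X] (hk : 0 < k) {R : Region X M k} {v : Val X} (hv : R.Mem v) :
    of M k v = R := eq_of_mem hk (mem_of hk (hv.le hk)) hv

end Region

/-! ### Closed regions and their corner points -/

namespace Region

variable {X : Type*} {M k : ℕ}

/-- On the closure of a region the strict conditions that define it hold weakly. -/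
theorem of_mem_closure (hk : 0 < k) {R : Region X M k} {α : Val X}
    (hα : α ∈ closure {v | R.Mem v}) :
    (∀ x, (R.num x : ℝ) ≤ k * α x ∧ (k : ℝ) * α x ≤ R.num x + 1) ∧
    (∀ x, R.block x = 0 → (k : ℝ) * α x = R.num x) ∧
    ∀ x y, R.block x ≤ R.block y → (k : ℝ) * α x - R.num x ≤ k * α y - R.num y := by
  have hmem : ∀ v, R.Mem v → ∀ x, (k : ℝ) * v x = R.num x + Int.fract ((k : ℝ) * v x) := by
    intro v hv x
    conv_lhs => rw [← Int.floor_add_fract ((k : ℝ) * v x), hv.1 x, Int.cast_natCast]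
  have hcont : ∀ x : X, Continuous fun v : Val X => (k : ℝ) * v x := fun x => by fun_prop
  refine ⟨fun x => ⟨?_, ?_⟩, fun x hx => ?_, fun x y hxy => ?_⟩
  · refine closure_minimal (fun v hv => ?_)
      (isClosed_le (f := fun _ => (R.num x : ℝ)) continuous_const (hcont x)) hα
    have h1 := hmem v hv x
    have h2 := Int.fract_nonneg ((k : ℝ) * v x)
    simp only [mem_ofPred_eq]
    linarith
  · refine closure_minimal (fun v hv => ?_)
      (isClosed_le (g := fun _ => (R.num x : ℝ) + 1) (hcont x) continuous_const) hα
    have h1 := hmem v hv x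
    have h2 := Int.fract_lt_one ((k : ℝ) * v x)
    simp only [mem_ofPred_eq]
    linarith
  · refine closure_minimal (fun v hv => ?_)
      (isClosed_eq (g := fun _ => (R.num x : ℝ)) (hcont x) continuous_const) hα
    have h1 := hmem v hv x
    rw [(((mem_iff hk).1 hv).2.1 x).2 hx, add_zero] at h1
    exact h1
  · refine closure_minimal (fun v hv => ?_)
      (isClosed_le (f := fun v : Val X => (k : ℝ) * v x - R.num x)
        (g := fun v : Val X => (k : ℝ) * v y - R.num y)
        ((hcont x).sub continuous_const) ((hcont y).sub continuous_const)) hα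
    have h1 := hmem v hv x
    have h2 := hmem v hv y
    have h3 := (hv.2.2 x y).2 hxy
    simp only [mem_ofPred_eq]
    linarith

theorem mul_corner (hk : 0 < k) (R : Region X M k) (i : ℕ) (x : X) :
    (k : ℝ) * R.corner i x = R.num x + if R.block x ≤ i then 0 else 1 := by
  have hk' : (k : ℝ) ≠ 0 := by positivity
  unfold corner h
  split_ifs
  · push_cast
    field_simp
    ring
  · push_cast
    field_simp

/-- Any point of the region can be moved towards a corner point without leaving the region before
the corner point is reached. -/
theorem corner_mem_closure (hk : 0 < k) (R : Region X M k) (i : ℕ) :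
    R.corner i ∈ closure {v | R.Mem v} := by
  obtain ⟨v, hv⟩ := R.nonempty hk
  have hv' := (mem_iff hk).1 hv
  let t : ℕ → ℝ≥0 := fun m => 1 / ((m : ℝ≥0) + 1)
  have ht : Tendsto t atTop (𝓝 0) := tendsto_one_div_add_atTop_nhds_zero_nat
  have ht1 : ∀ m, t m ≤ 1 := fun m => by
    simp only [t]
    rw [div_le_one (by positivity)]
    exact le_add_self
  have ht0 : ∀ m, 0 < t m := fun m => by simp only [t]; positivity
  refine mem_closure_of_tendsto
    (f := fun (m : ℕ) (x : X) => (1 - t m) * R.corner i x + t m * v x) (b := atTop) ?_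
    (Eventually.of_forall fun m => ?_)
  · rw [tendsto_pi_nhds]
    intro x
    have h1 := ((tendsto_const_nhds (x := (1 : ℝ≥0))).sub ht).mul_const (R.corner i x)
    have h2 := h1.add (ht.mul_const (v x))
    simpa using h2
  · have h1 : (0 : ℝ) < t m := ht0 m
    have h2 : (t m : ℝ) ≤ 1 := ht1 m
    let χ : X → ℝ := fun x => if R.block x ≤ i then 0 else 1
    have hχ : ∀ x, R.block x = 0 → χ x = 0 := fun x hx => by simp [χ, hx]
    have hχ01 : ∀ x, 0 ≤ χ x ∧ χ x ≤ 1 := fun x => by simp only [χ]; split_ifs <;> norm_num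
    have hχm : ∀ x y, R.block x ≤ R.block y → χ x ≤ χ y := fun x y hxy => by
      simp only [χ]
      split_ifs <;> first | omega | norm_num
    refine mem_of_eq_add hk
      (φ := fun x => (1 - t m) * χ x + t m * Int.fract ((k : ℝ) * v x)) (fun x => ?_)
      (fun x => ⟨?_, ?_⟩) (fun x => ?_) (fun x y => ⟨fun hxy => ?_, fun hxy => ?_⟩)
    · have h3 := mul_corner hk R i x
      have h4 := Int.floor_add_fract ((k : ℝ) * v x)
      rw [hv.1 x, Int.cast_natCast] at h4
      rw [NNReal.coe_add, NNReal.coe_mul, NNReal.coe_mul, NNReal.coe_sub (ht1 m), NNReal.coe_one]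
      simp only [χ]
      linear_combination (1 - (t m : ℝ)) * h3 - (t m : ℝ) * h4
    · have := (hχ01 x).1
      have := Int.fract_nonneg ((k : ℝ) * v x)
      have : (0 : ℝ) ≤ 1 - t m := by linarith
      positivity
    · have := (hχ01 x).2
      have := Int.fract_lt_one ((k : ℝ) * v x)
      nlinarith
    · have h3 := (hχ01 x).1
      have h4 := Int.fract_nonneg ((k : ℝ) * v x)
      have h5 : (0 : ℝ) ≤ 1 - t m := by linarith
      rw [← hv'.2.1 x]
      constructor
      · intro h
        have := mul_nonneg h5 h3
        have := mul_nonneg h1.le h4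
        have h6 : (t m : ℝ) * Int.fract ((k : ℝ) * v x) = 0 := by linarith
        exact (mul_eq_zero.1 h6).resolve_left h1.ne'
      · intro h
        simp [h, hχ x ((hv'.2.1 x).1 h)]
    · by_contra! hlt
      have h3 := hχm y x hlt.le
      have h4 : Int.fract ((k : ℝ) * v y) < Int.fract ((k : ℝ) * v x) := by
        rw [← not_le, hv'.2.2 x y]
        omega
      nlinarith
    · have h3 := hχm x y hxy
      have h4 := (hv'.2.2 x y).2 hxy
      have h5 : (0 : ℝ) ≤ 1 - t m := by linarith
      have := mul_le_mul_of_nonneg_left h3 h5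
      have := mul_le_mul_of_nonneg_left h4 h1.le
      linarith

/-- The closed region is spanned by its corner points: the weight of the corner point `aᵢ` is the
gap between the fractional parts of the blocks `i` and `i + 1`. -/
theorem exists_weights (hk : 0 < k) {R : Region X M k} {α : Val X}
    (hα : α ∈ closure {v | R.Mem v}) : ∃ w : PMF (Fin (R.n + 1)),
      ∀ x, (α x : ℝ) = ∑ i, (w i).toReal * R.corner i x := by
  classical
  obtain ⟨h1, h2, h3⟩ := of_mem_closure hk hα
  have hk' : (k : ℝ) ≠ 0 := by positivity
  let φ : X → ℝ := fun x => k * α x - R.num x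
  have hφ : ∀ x y, R.block x = R.block y → φ x = φ y := fun x y h =>
    le_antisymm (h3 x y h.le) (h3 y x h.ge)
  have hφ01 : ∀ x, 0 ≤ φ x ∧ φ x ≤ 1 := fun x => by
    have := h1 x
    constructor <;> simp only [φ] <;> linarith
  -- the fractional part in the block `j`, with the conventions `θ 0 = 0` and `θ (n + 1) = 1`
  let θ : ℕ → ℝ := fun j =>
    if j = 0 then 0 else if h : ∃ x, R.block x = j then φ h.choose else 1
  have hθ : ∀ x, θ (R.block x) = φ x := by
    intro x
    simp only [θ]
    split_ifs with h0 hx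
    · simp only [φ, h2 x h0, sub_self]
    · exact hφ _ _ hx.choose_spec
    · exact absurd ⟨x, rfl⟩ hx
  have hθ0 : θ 0 = 0 := if_pos rfl
  have hθn : θ (R.n + 1) = 1 := by
    simp only [θ]
    rw [if_neg (Nat.succ_ne_zero _), dif_neg]
    rintro ⟨x, hx⟩
    have := R.block_le x
    omega
  have hθm : ∀ i, i ≤ R.n → θ i ≤ θ (i + 1) := by
    intro i hi
    rcases hi.eq_or_lt with rfl | hi'
    · rw [hθn]
      rcases Nat.eq_zero_or_pos R.n with h0 | h0
      · rw [h0, hθ0]; norm_num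
      · obtain ⟨x, hx⟩ := R.block_nonempty _ h0 le_rfl
        rw [← hx, hθ]
        exact (hφ01 x).2
    · obtain ⟨y, hy⟩ := R.block_nonempty (i + 1) (by omega) hi'
      rw [← hy, hθ]
      rcases Nat.eq_zero_or_pos i with h0 | h0
      · rw [h0, hθ0]
        exact (hφ01 y).1
      · obtain ⟨x, hx⟩ := R.block_nonempty i h0 hi
        rw [← hx, hθ]
        exact h3 x y (by omega)
  have hnn : ∀ i : Fin (R.n + 1), 0 ≤ θ (i + 1) - θ i := fun i =>
    sub_nonneg.2 (hθm i (Nat.lt_succ_iff.1 i.2))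
  have hsum : ∑ i : Fin (R.n + 1), ENNReal.ofReal (θ (i + 1) - θ i) = 1 := by
    rw [← ENNReal.ofReal_sum_of_nonneg fun i _ => hnn i,
      Fin.sum_univ_eq_sum_range (fun i => θ (i + 1) - θ i), Finset.sum_range_sub, hθn, hθ0]
    simp
  refine ⟨PMF.ofFintype _ hsum, fun x => ?_⟩
  have hlt : ∑ i : Fin (R.n + 1), (θ (i + 1) - θ i) * (if R.block x ≤ i then (0 : ℝ) else 1) =
      φ x := by
    rw [Fin.sum_univ_eq_sum_range
      (fun i => (θ (i + 1) - θ i) * (if R.block x ≤ i then (0 : ℝ) else 1))]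
    simp only [mul_ite, mul_zero, mul_one]
    rw [Finset.sum_ite, Finset.sum_const_zero, zero_add]
    have : (Finset.range (R.n + 1)).filter (fun i => ¬ R.block x ≤ i) =
        Finset.range (R.block x) := by
      ext i
      have := R.block_le x
      simp only [Finset.mem_filter, Finset.mem_range]
      omega
    rw [this, Finset.sum_range_sub, hθ, hθ0, sub_zero]
  have hone : ∑ i : Fin (R.n + 1), (θ (i + 1) - θ i) = 1 := by
    rw [Fin.sum_univ_eq_sum_range (fun i => θ (i + 1) - θ i), Finset.sum_range_sub, hθn, hθ0,
      sub_zero]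
  refine mul_left_cancel₀ hk' ?_
  simp only [PMF.ofFintype_apply]
  rw [Finset.mul_sum]
  calc (k : ℝ) * α x = R.num x * 1 + φ x := by simp [φ]
    _ = ∑ i : Fin (R.n + 1), (θ (i + 1) - θ i) *
          (R.num x + if R.block x ≤ i then (0 : ℝ) else 1) := by
      simp only [mul_add, Finset.sum_add_distrib]
      rw [hlt, ← Finset.sum_mul, hone, mul_comm]
    _ = _ := by
      refine Finset.sum_congr rfl fun i _ => ?_
      rw [ENNReal.toReal_ofReal (hnn i), ← mul_corner hk]
      ring

end Region

/-! ### Piecewise linear edges on closed regions -/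

/-- A continuous function that is affine on an open interval keeps its affine limit at the end
points, along any larger interval of definition. -/
theorem tendsto_nhdsWithin_of_affine {I : Set ℝ≥0} (hI : I.OrdConnected) {f : ℝ≥0 → ℝ}
    (hf : ContinuousOn f I) {a b : ℝ≥0} (hab : a < b) (hsub : Ioo a b ⊆ I) {c d : ℝ}
    (hcd : ∀ γ ∈ Ioo a b, f γ = c + d * γ) {α : ℝ≥0} (hα : α ∈ Icc a b) :
    Tendsto f (𝓝[I] α) (𝓝 (c + d * α)) := by
  have hg : Continuous fun γ : ℝ≥0 => c + d * (γ : ℝ) := by fun_prop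
  have hIoo : Tendsto f (𝓝[Ioo a b] α) (𝓝 (c + d * α)) := by
    refine ((hg.tendsto α).mono_left nhdsWithin_le_nhds).congr' ?_
    filter_upwards [self_mem_nhdsWithin] with γ hγ using (hcd γ hγ).symm
  by_cases hαI : α ∈ I
  · have hne : (𝓝[Ioo a b] α).NeBot := by
      rw [← mem_closure_iff_nhdsWithin_neBot, closure_Ioo hab.ne]
      exact hα
    have := tendsto_nhds_unique ((hf α hαI).mono_left (nhdsWithin_mono α hsub)) hIoo
    rw [← this]
    exact hf α hαI
  · obtain ⟨m, hm⟩ := exists_between hab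
    rcases hα.1.eq_or_lt with rfl | ha
    · have hle : I ⊆ Ioi a := fun γ hγ => by
        by_contra hlt
        exact hαI (hI.out hγ (hsub hm) ⟨not_lt.1 hlt, hm.1.le⟩)
      rw [nhdsWithin_Ioo_eq_nhdsGT hab] at hIoo
      exact hIoo.mono_left (nhdsWithin_mono _ hle)
    · rcases hα.2.eq_or_lt with rfl | hb
      · have hle : I ⊆ Iio α := fun γ hγ => by
          by_contra hlt
          exact hαI (hI.out (hsub hm) hγ ⟨hm.2.le, not_lt.1 hlt⟩)
        rw [nhdsWithin_Ioo_eq_nhdsLT hab] at hIoo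
        exact hIoo.mono_left (nhdsWithin_mono _ hle)
      · exact absurd (hsub ⟨ha, hb⟩) hαI

/-- An interval with natural endpoints that meets `(m, m + 1)` contains it. -/
theorem IsNatInterval.Ioo_subset {J : Set ℝ≥0} (hJ : IsNatInterval J) {m : ℕ} {γ : ℝ≥0}
    (hγ : γ ∈ J) (h1 : (m : ℝ≥0) < γ) (h2 : γ < m + 1) : Ioo (m : ℝ≥0) (m + 1) ⊆ J := by
  obtain ⟨a, b, hJ⟩ := hJ
  have hab : (a : ℝ≥0) ≤ γ ∧ γ ≤ b := by
    rcases hJ with rfl | rfl | rfl | rfl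
    exacts [hγ, ⟨hγ.1, hγ.2.le⟩, ⟨hγ.1.le, hγ.2⟩, ⟨hγ.1.le, hγ.2.le⟩]
  have ha : a ≤ m := by
    have : (a : ℝ≥0) < (m + 1 : ℕ) := by push_cast; exact hab.1.trans_lt h2
    have := Nat.cast_lt.1 this
    omega
  have hb : m + 1 ≤ b := by
    have : (m : ℝ≥0) < b := h1.trans_le hab.2
    exact Nat.cast_lt.1 this
  have ha' : (a : ℝ≥0) ≤ m := by exact_mod_cast ha
  have hb' : (m : ℝ≥0) + 1 ≤ b := by exact_mod_cast hb
  intro δ hδ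
  have h3 := ha'.trans_lt hδ.1
  have h4 := hδ.2.trans_le hb'
  rcases hJ with rfl | rfl | rfl | rfl
  exacts [⟨h3.le, h4.le⟩, ⟨h3.le, h4⟩, ⟨h3, h4.le⟩, ⟨h3, h4⟩]

namespace ProbEdge

variable {L X : Type*}

theorem ordConnected_interval (p : ProbEdge L X) (x : X) : (p.interval x).OrdConnected := by
  classical
  refine ⟨?_⟩
  rintro _ ⟨v, hv, rfl⟩ _ ⟨w, hw, rfl⟩ γ ⟨h1, h2⟩
  refine ⟨Function.update v x γ, fun a ha => ?_, by simp⟩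
  by_cases hax : a.clock = x
  · subst hax
    have hva := hv a ha
    have hwa := hw a ha
    rw [Function.update_self]
    rcases hc : a.cmp <;> rw [hc] at hva hwa <;> simp only [Cmp.holds] at hva hwa ⊢
    exacts [h2.trans_lt hwa, h2.trans hwa, hva.trans h1, hva.trans_le h1]
  · rw [Function.update_of_ne hax]
    exact hv a ha

theorem tendsto_templ [Fintype X] {p : ProbEdge L X} {f : X → ℝ≥0 → ℝ} {e : Finset X × L}
    (hf : ∀ v : Val X, v.Sat p.guard → (p.templ v e).toReal = ∑ x, f x (v x)) {α : Val X}
    {ℓ : X → ℝ} (hℓ : ∀ x, Tendsto (f x) (𝓝[p.interval x] (α x)) (𝓝 (ℓ x))) :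
    Tendsto (fun v => (p.templ v e).toReal) (𝓝[{v : Val X | v.Sat p.guard}] α)
      (𝓝 (∑ x, ℓ x)) := by
  have h1 : Tendsto (fun v : Val X => ∑ x, f x (v x)) (𝓝[{v : Val X | v.Sat p.guard}] α)
      (𝓝 (∑ x, ℓ x)) := by
    refine tendsto_finsetSum _ fun x _ => (hℓ x).comp ?_
    refine tendsto_nhdsWithin_iff.2 ⟨((continuous_apply x).tendsto α).mono_left
      nhdsWithin_le_nhds, ?_⟩
    filter_upwards [self_mem_nhdsWithin] with v hv using ⟨v, hv, rfl⟩
  refine h1.congr' ?_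
  filter_upwards [self_mem_nhdsWithin] with v hv using (hf v hv).symm

theorem probAt_of_sat [Fintype X] {p : ProbEdge L X} (hp : p.IsPiecewiseLinear) {v : Val X}
    (hv : v.Sat p.guard) (e : Finset X × L) : p.probAt v e = (p.templ v e).toReal := by
  obtain ⟨f, hf, hs⟩ := hp
  refine extendFrom_eq (subset_closure hv) ?_
  rw [hs v hv e]
  exact tendsto_templ (fun v hv => hs v hv e) fun x => (hf e x).1 _ ⟨v, hv, rfl⟩

/-- On a closed region whose points satisfy the guard, the limits that define `probAt` exist and
form an affine function. -/
theorem exists_affine [Fintype X] {p : ProbEdge L X} (hp : p.IsPiecewiseLinear) {M k : ℕ}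
    (hk : 0 < k) {R : Region X M k} (hR : R.Sat p.guard) (e : Finset X × L) :
    ∃ c d : X → ℝ, ∀ α ∈ closure {v | R.Mem v},
      Tendsto (fun v => (p.templ v e).toReal) (𝓝[{v : Val X | v.Sat p.guard}] α)
        (𝓝 (∑ x, (c x + d x * α x))) ∧
      p.probAt α e = ∑ x, (c x + d x * α x) := by
  obtain ⟨f, hf, hs⟩ := hp
  obtain ⟨v, hv⟩ := R.nonempty hk
  have hk' : (0 : ℝ) < k := by positivity
  have hvI : ∀ x, v x ∈ p.interval x := fun x => ⟨v, hR v hv, rfl⟩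
  have key : ∀ x, ∃ c d : ℝ, ∀ α ∈ closure {v | R.Mem v},
      Tendsto (f e x) (𝓝[p.interval x] (α x)) (𝓝 (c + d * α x)) := by
    intro x
    by_cases hx : R.block x = 0
    · refine ⟨f e x (v x), 0, fun α hα => ?_⟩
      have h1 := (Region.of_mem_closure hk hα).2.1 x hx
      have h2 := (Region.of_mem_closure hk (subset_closure hv)).2.1 x hx
      have h3 : α x = v x := NNReal.coe_injective (mul_left_cancel₀ hk'.ne' (h1.trans h2.symm))
      rw [h3, zero_mul, add_zero]
      exact (hf e x).1 _ (hvI x)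
    · obtain ⟨hfc, 𝓘, hnat, hU, -, haff⟩ := hf e x
      obtain ⟨J, hJ, hvJ⟩ : v x ∈ ⋃₀ 𝓘 := hU ▸ hvI x
      obtain ⟨c, d, hcd⟩ := haff J hJ
      -- the unit interval that contains the values of `x` in the region
      let m := R.num x / k
      have hm1 : ((m : ℝ) * k ≤ R.num x) := by exact_mod_cast Nat.div_mul_le_self _ _
      have hm2 : ((R.num x : ℝ) + 1 ≤ (m + 1) * k) := by
        exact_mod_cast Nat.lt_mul_of_div_lt (Nat.lt_succ_self m) hk
      have hfr := Int.floor_add_fract ((k : ℝ) * v x)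
      rw [hv.1 x, Int.cast_natCast] at hfr
      have hpos : 0 < Int.fract ((k : ℝ) * v x) := lt_of_le_of_ne (Int.fract_nonneg _)
        fun h => hx ((((Region.mem_iff hk).1 hv).2.1 x).1 h.symm)
      have hlt := Int.fract_lt_one ((k : ℝ) * v x)
      have h1 : (m : ℝ≥0) < v x := by
        have : (m : ℝ) < v x := by nlinarith
        exact_mod_cast this
      have h2 : v x < (m : ℝ≥0) + 1 := by
        have : (v x : ℝ) < m + 1 := by nlinarith
        exact_mod_cast this
      have hsub := (hnat J hJ).Ioo_subset hvJ h1 h2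
      refine ⟨c, d, fun α hα => ?_⟩
      refine tendsto_nhdsWithin_of_affine (p.ordConnected_interval x) hfc (h1.trans h2)
        (hsub.trans (hU ▸ subset_sUnion_of_mem hJ)) (fun γ hγ => hcd γ (hsub hγ)) ⟨?_, ?_⟩
      · have h3 := ((Region.of_mem_closure hk hα).1 x).1
        have : (m : ℝ) ≤ α x := by nlinarith
        exact_mod_cast this
      · have h3 := ((Region.of_mem_closure hk hα).1 x).2
        have : (α x : ℝ) ≤ m + 1 := by nlinarith
        exact_mod_cast this
  choose c d hcd using key
  refine ⟨c, d, fun α hα => ?_⟩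
  have ht := tendsto_templ (fun v hv => hs v hv e) fun x => hcd x α hα
  exact ⟨ht, extendFrom_eq (closure_mono (fun v hv => hR v hv) hα) ht⟩

/-- The limit probabilities at a point of the closed region are those of a distribution. The
number of outcomes has to be finite: the limits of infinitely many could lose mass. -/
theorem exists_pmf_probAt [Fintype X] [Finite L] {p : ProbEdge L X} (hp : p.IsPiecewiseLinear)
    {M k : ℕ} (hk : 0 < k) {R : Region X M k} (hR : R.Sat p.guard) {α : Val X}
    (hα : α ∈ closure {v | R.Mem v}) :
    ∃ q : PMF (Finset X × L), ∀ e, (q e).toReal = p.probAt α e := by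
  have := Fintype.ofFinite L
  have ht : ∀ e, Tendsto (fun v => (p.templ v e).toReal) (𝓝[{v : Val X | v.Sat p.guard}] α)
      (𝓝 (p.probAt α e)) := fun e => by
    obtain ⟨c, d, h⟩ := exists_affine hp hk hR e
    rw [(h α hα).2]
    exact (h α hα).1
  have hne : (𝓝[{v : Val X | v.Sat p.guard}] α).NeBot :=
    mem_closure_iff_nhdsWithin_neBot.1 (closure_mono (fun v hv => hR v hv) hα)
  have hnn : ∀ e, 0 ≤ p.probAt α e := fun e =>
    ge_of_tendsto' (ht e) fun v => ENNReal.toReal_nonneg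
  have hsum : ∑ e, p.probAt α e = 1 := by
    refine tendsto_nhds_unique (tendsto_finsetSum _ fun e _ => ht e)
      (tendsto_const_nhds.congr fun v => ?_)
    rw [← ENNReal.toReal_sum fun e _ => PMF.apply_ne_top _ e, ← tsum_fintype (L := .unconditional _),
      PMF.tsum_coe, ENNReal.toReal_one]
  refine ⟨PMF.ofFintype (fun e => ENNReal.ofReal (p.probAt α e)) ?_, fun e => ?_⟩
  · rw [← ENNReal.ofReal_sum_of_nonneg fun e _ => hnn e, hsum, ENNReal.ofReal_one]
  · rw [PMF.ofFintype_apply, ENNReal.toReal_ofReal (hnn e)]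

end ProbEdge

/-! ### The region graph simulates the semantics and the finer region graphs -/

namespace CdPTA

variable {L X : Type*} [Fintype X] [DecidableEq X] {M k : ℕ}

/-- The sums in the definition of the edge transitions of the region graph are the probabilities
of an image distribution. -/
theorem toReal_map_reset (hk : 0 < k) {R : Region X M k} {v : Val X} (hv : R.Mem v)
    (q : PMF (Finset X × L)) (l' : L) (R' : Region X M k) :
    ((q.map fun e => (e.2, Region.of M k (v.reset e.1))) (l', R')).toReal =
      open Classical in
      ∑ Y ∈ Finset.univ.filter (fun Y : Finset X => R.IsReset Y R'), (q (Y, l')).toReal := by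
  classical
  have hM : ∀ Y x, v.reset Y x ≤ M := fun Y x => by
    unfold Val.reset
    split_ifs
    exacts [zero_le, hv.le hk x]
  have hof : ∀ Y, R' = Region.of M k (v.reset Y) ↔ R.IsReset Y R' := fun Y => by
    rw [Region.isReset_iff hk hv]
    exact ⟨fun h => h ▸ Region.mem_of hk (hM Y), fun h => (h.of_eq hk).symm⟩
  rw [PMF.map_apply, ENNReal.tsum_prod', tsum_fintype, Finset.sum_filter,
    ENNReal.toReal_sum]
  · refine Finset.sum_congr rfl fun Y _ => ?_
    rw [tsum_eq_single l']
    · simp only [Prod.mk.injEq, true_and, hof Y]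
      split_ifs <;> rfl
    · intro l'' hl
      simp [hl.symm]
  · intro Y _
    rw [tsum_eq_single l']
    · split_ifs
      exacts [PMF.apply_ne_top _ _, ENNReal.zero_ne_top]
    · intro l'' hl
      simp [hl.symm]

/-- An edge taken at a point of a closed region is a randomized choice between the edge
transitions of the region graph at the corner points. -/
theorem exists_corner_choice [Finite L] (P : CdPTA L X) (hP : P.Standing) (hk : 0 < k)
    {R : Region X M k} {v : Val X} (hv : R.Mem v) {p : ProbEdge L X} (hp : p ∈ P.prob)
    (hR : R.Sat p.guard) {α : Val X} (hα : α ∈ closure {v | R.Mem v})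
    {q : PMF (Finset X × L)} (hq : ∀ e, (q e).toReal = p.probAt α e) :
    ∃ c : PMF (RState L X M k × RAction L X × PMF (RState L X M k)),
      (∀ t' ∈ c.support, t' ∈ P.rEdgeTrans M k ∧ t'.1 = (p.source, R)) ∧
      c.bind (fun t' => t'.2.2) = q.map fun e => (e.2, Region.of M k (v.reset e.1)) := by
  have hpl := hP.piecewiseLinear p hp
  obtain ⟨w, hw⟩ := Region.exists_weights hk hα
  choose qc hqc using fun i : Fin (R.n + 1) =>
    ProbEdge.exists_pmf_probAt hpl hk hR (R.corner_mem_closure hk i)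
  have hmix : w.bind qc = q := by
    ext e
    rw [← ENNReal.toReal_eq_toReal_iff' (PMF.apply_ne_top _ _) (PMF.apply_ne_top _ _), hq,
      PMF.bind_apply, tsum_fintype,
      ENNReal.toReal_sum fun i _ => ENNReal.mul_ne_top (PMF.apply_ne_top _ _) (PMF.apply_ne_top _ _)]
    obtain ⟨c, d, hcd⟩ := ProbEdge.exists_affine hpl hk hR e
    have hone : ∑ i, (w i).toReal = 1 := by
      rw [← ENNReal.toReal_sum fun i _ => PMF.apply_ne_top _ i,
        ← tsum_fintype (L := .unconditional _), PMF.tsum_coe, ENNReal.toReal_one]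
    simp only [ENNReal.toReal_mul, hqc, (hcd α hα).2,
      fun i : Fin (R.n + 1) => (hcd _ (R.corner_mem_closure hk i)).2, Finset.mul_sum]
    rw [Finset.sum_comm]
    refine Finset.sum_congr rfl fun x _ => ?_
    rw [hw x, Finset.mul_sum]
    simp only [mul_add, Finset.sum_add_distrib, ← Finset.sum_mul, hone, one_mul]
    exact congrArg _ (Finset.sum_congr rfl fun i _ => by ring)
  refine ⟨w.map fun i : Fin (R.n + 1) => ((p.source, R), RAction.edge (R.corner i) p,
    (qc i).map fun e => (e.2, Region.of M k (v.reset e.1))), ?_, ?_⟩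
  · intro t' ht'
    rw [PMF.support_map] at ht'
    obtain ⟨i, -, rfl⟩ := ht'
    refine ⟨⟨_, R, R.corner i, p, _, hp, rfl, hR, ⟨i, Nat.lt_succ_iff.1 i.2, rfl⟩,
      fun l' R' => ?_, rfl⟩, rfl⟩
    rw [toReal_map_reset hk hv]
    exact Finset.sum_congr rfl fun Y _ => hqc i _
  · rw [PMF.bind_map, ← hmix, PMF.map_bind]
    rfl

theorem disjoint_timeTrans_edgeTrans (P : CdPTA L X) : Disjoint P.timeTrans P.edgeTrans := by
  rw [Set.disjoint_left]
  rintro t ⟨s, s', δ, -, -, -, rfl⟩ ⟨s₂, p, μ, -, -, -, -, h⟩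
  simp at h

theorem disjoint_rTimeTrans_rEdgeTrans (P : CdPTA L X) :
    Disjoint (P.rTimeTrans M k) (P.rEdgeTrans M k) := by
  rw [Set.disjoint_left]
  rintro t ⟨l, R, R', -, rfl⟩ ⟨l₂, R₂, α, p, ν, -, -, -, -, -, h⟩
  simp at h

/-- The targets of an edge transition of the semantics are distributed as the outcomes of the
template; no outcome of positive probability is lost, since it satisfies its invariant. -/
theorem map_edgeTrans (P : CdPTA L X) (hP : P.Standing) {s : P.State} {p : ProbEdge L X}
    (hp : p ∈ P.prob) (hs : s.val.Sat p.guard) {μ : PMF P.State}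
    (hμ : ∀ s' : P.State, μ s' = open Classical in
      ∑ Y ∈ Finset.univ.filter (fun Y : Finset X => s.val.reset Y = s'.val),
        p.templ s.val (Y, s'.loc)) :
    μ.map (fun s' => (s'.loc, s'.val)) =
      (p.templ s.val).map fun e => (e.2, s.val.reset e.1) := by
  classical
  ext ⟨l', v'⟩
  have hR : ((p.templ s.val).map fun e => (e.2, s.val.reset e.1)) (l', v') =
      ∑ Y, if s.val.reset Y = v' then p.templ s.val (Y, l') else 0 := by
    rw [PMF.map_apply, ENNReal.tsum_prod', tsum_fintype]
    refine Finset.sum_congr rfl fun Y _ => ?_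
    rw [tsum_eq_single l']
    · simp only [Prod.mk.injEq, true_and, eq_comm]
    · intro l'' hl
      simp [hl.symm]
  rw [hR, PMF.map_apply]
  by_cases hv' : v'.Sat (P.inv l')
  · rw [tsum_eq_single (⟨l', v', hv'⟩ : P.State)]
    · rw [if_pos rfl, hμ, Finset.sum_filter]
    · intro s' hs'
      refine if_neg fun h => ?_
      simp only [Prod.mk.injEq] at h
      exact hs' (State.ext h.1.symm h.2.symm)
  · refine (ENNReal.tsum_eq_zero.2 fun s' => if_neg fun h => hv' ?_).trans
      (Finset.sum_eq_zero fun Y _ => ?_).symm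
    · simp only [Prod.mk.injEq] at h
      rw [h.1, h.2]
      exact s'.sat
    · by_contra hne
      obtain ⟨hY, h0⟩ := ite_ne_right_iff.1 hne
      rw [← hY] at hv'
      exact hv' (hP.target_sat p hp _ hs Y l' (pos_iff_ne_zero.2 h0))

/-- The region graph imitates the semantics: at the valuation `v` it randomizes over the corner
points of the region of `v`. -/
theorem exists_rStrategy_of_strategy [Finite L] (P : CdPTA L X) (hP : P.Standing)
    (hM : P.ClockBound M) (F : Set L) (hk : 0 < k) {σ : PTS.StrategyFun P.State (Action L X)}
    (hσ : σ ∈ P.strategies) : ∃ σ' ∈ P.rStrategies M k,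
      (P.regionGraph M k).probReach σ' (rTargets F X M k) = P.sem.probReach σ (P.targets F) := by
  let f : P.State → RState L X M k := fun s => (s.loc, Region.of M k s.val)
  have hmem : ∀ s : P.State, (Region.of M k s.val).Mem s.val := fun s =>
    Region.mem_of hk (hM _ _ s.sat)
  refine Exists.imp (fun σ' h => ⟨⟨h.1, h.2.1⟩, h.2.2⟩) (P.sem.exists_strategy_of_simulation (P.regionGraph M k)
    (D := P.timeTrans) (E := P.edgeTrans) (D' := P.rTimeTrans M k) (E' := P.rEdgeTrans M k)
    rfl rfl P.disjoint_timeTrans_edgeTrans P.disjoint_rTimeTrans_rEdgeTrans f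
    (Prod.ext rfl (Region.mem_zero.of_eq hk)) ?_ ?_ hσ.1 hσ.2 (rTargets F X M k))
  · rintro t ⟨s, s', δ, hδ, hl, hv, rfl⟩
    refine ⟨PMF.pure (f s, RAction.tau, PMF.pure (f s')), fun t' ht' => ?_, ?_⟩
    · rw [PMF.mem_support_pure_iff] at ht'
      subst ht'
      exact ⟨⟨s.loc, _, Region.of M k s'.val, ⟨s.val, δ, hmem s, hv ▸ hmem s', hδ⟩,
        Prod.ext rfl (Prod.ext rfl (congrArg PMF.pure (Prod.ext hl rfl)))⟩, rfl⟩
    · simp [PMF.pure_map]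
  · rintro t ⟨s, p, μ, hp, hl, hs, hμ, rfl⟩
    obtain ⟨c, hc, hcb⟩ := P.exists_corner_choice hP hk (hmem s) hp ((hmem s).sat hk hs)
      (subset_closure (hmem s)) (q := p.templ s.val)
      fun e => (ProbEdge.probAt_of_sat (hP.piecewiseLinear p hp) hs e).symm
    refine ⟨c, fun t' ht' => ⟨(hc t' ht').1, (hc t' ht').2.trans (Prod.ext hl rfl)⟩, ?_⟩
    have h := congrArg (PMF.map fun y : L × Val X => (y.1, Region.of M k y.2))
      (P.map_edgeTrans hP hp hs hμ)
    simp only [PMF.map_comp] at h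
    rw [hcb]
    exact h.symm

/-- The region graph imitates the one of doubled granularity: for a corner point of a `2k`-region
it randomizes over the corner points of the `k`-region around it. -/
theorem exists_rStrategy_of_rStrategy_two_mul [Finite L] (P : CdPTA L X) (hP : P.Standing)
    (F : Set L) (hk : 0 < k)
    {σ : PTS.StrategyFun (RState L X M (2 * k)) (RAction L X)}
    (hσ : σ ∈ P.rStrategies M (2 * k)) : ∃ σ' ∈ P.rStrategies M k,
      (P.regionGraph M k).probReach σ' (rTargets F X M k) =
        (P.regionGraph M (2 * k)).probReach σ (rTargets F X M (2 * k)) := by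
  have h2k : 0 < 2 * k := by omega
  have hcoarse : ∀ R : Region X M (2 * k), ∃ R₁ : Region X M k, ∀ v, R.Mem v → R₁.Mem v := by
    intro R
    obtain ⟨v, hv⟩ := R.nonempty h2k
    exact ⟨Region.of M k v, fun w hw =>
      (Region.mem_of hk (hv.le h2k)).of_equiv hk (hv.equiv h2k hw).of_two_mul⟩
  choose g hg using hcoarse
  let f : RState L X M (2 * k) → RState L X M k := fun s => (s.1, g s.2)
  refine Exists.imp (fun σ' h => ⟨⟨h.1, h.2.1⟩, h.2.2⟩) ((P.regionGraph M (2 * k)).exists_strategy_of_simulation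
    (P.regionGraph M k) (D := P.rTimeTrans M (2 * k)) (E := P.rEdgeTrans M (2 * k))
    (D' := P.rTimeTrans M k) (E' := P.rEdgeTrans M k)
    rfl rfl P.disjoint_rTimeTrans_rEdgeTrans P.disjoint_rTimeTrans_rEdgeTrans f
    (Prod.ext rfl (Region.eq_of_mem hk (hg _ _ Region.mem_zero) Region.mem_zero))
    ?_ ?_ hσ.1 hσ.2 (rTargets F X M k))
  · rintro t ⟨l, R, R', ⟨v, δ, hv, hv', hδ⟩, rfl⟩
    refine ⟨PMF.pure ((l, g R), RAction.tau, PMF.pure (l, g R')), fun t' ht' => ?_, ?_⟩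
    · rw [PMF.mem_support_pure_iff] at ht'
      subst ht'
      exact ⟨⟨l, _, _, ⟨v, δ, hg _ _ hv, hg _ _ hv', hδ⟩, rfl⟩, rfl⟩
    · simp [PMF.pure_map, f]
  · rintro t ⟨l, R, α, p, ν, hp, rfl, hR, ⟨i, -, rfl⟩, hν, rfl⟩
    obtain ⟨v, hv⟩ := R.nonempty h2k
    have hcl := R.corner_mem_closure h2k i
    obtain ⟨q, hq⟩ := ProbEdge.exists_pmf_probAt (hP.piecewiseLinear p hp) h2k hR hcl
    have hνq : ν = q.map fun e => (e.2, Region.of M (2 * k) (v.reset e.1)) := by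
      ext ⟨l', R'⟩
      rw [← ENNReal.toReal_eq_toReal_iff' (PMF.apply_ne_top _ _) (PMF.apply_ne_top _ _), hν,
        toReal_map_reset h2k hv]
      exact Finset.sum_congr rfl fun Y _ => (hq _).symm
    obtain ⟨c, hc, hcb⟩ := P.exists_corner_choice hP hk (hg _ _ hv) hp
      ((hg _ _ hv).sat hk (hR v hv)) (closure_mono (fun w hw => hg R w hw) hcl) hq
    refine ⟨c, hc, ?_⟩
    rw [hcb, hνq, PMF.map_comp]
    refine congrArg (fun u => PMF.map u q) (funext fun e => Prod.ext rfl ?_)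
    have hM : ∀ x, v.reset e.1 x ≤ M := fun x => by
      unfold Val.reset
      split_ifs
      exacts [zero_le, hv.le h2k x]
    exact (hg _ _ (Region.mem_of h2k hM)).of_eq hk

end CdPTA

end

theorem proposition1 {L X : Type*} [Finite L] [Fintype X] [DecidableEq X]
    (P : CdPTA L X) (hP : P.Standing) (M : ℕ) (hM : P.ClockBound M)
    (F : Set L) (k : ℕ) (hk : 0 < k) :
    (P.sem.maxVal (P.targets F) P.strategies ≤
        (P.regionGraph M k).maxVal (CdPTA.rTargets F X M k) (P.rStrategies M k) ∧
      P.sem.minVal (P.targets F) P.strategies ≥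
        (P.regionGraph M k).minVal (CdPTA.rTargets F X M k) (P.rStrategies M k)) ∧
    ((P.regionGraph M (2 * k)).maxVal (CdPTA.rTargets F X M (2 * k)) (P.rStrategies M (2 * k)) ≤
        (P.regionGraph M k).maxVal (CdPTA.rTargets F X M k) (P.rStrategies M k) ∧
      (P.regionGraph M (2 * k)).minVal (CdPTA.rTargets F X M (2 * k)) (P.rStrategies M (2 * k)) ≥
        (P.regionGraph M k).minVal (CdPTA.rTargets F X M k) (P.rStrategies M k)) := by
  refine ⟨⟨iSup₂_le fun σ hσ => ?_, le_iInf₂ fun σ hσ => ?_⟩,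
    iSup₂_le fun σ hσ => ?_, le_iInf₂ fun σ hσ => ?_⟩
  · obtain ⟨σ', hσ', h⟩ := P.exists_rStrategy_of_strategy hP hM F hk hσ
    exact h ▸ le_iSup₂ (f := fun σ _ => PTS.probReach _ σ _) σ' hσ'
  · obtain ⟨σ', hσ', h⟩ := P.exists_rStrategy_of_strategy hP hM F hk hσ
    exact h ▸ iInf₂_le (f := fun σ _ => PTS.probReach _ σ _) σ' hσ'
  · obtain ⟨σ', hσ', h⟩ := P.exists_rStrategy_of_rStrategy_two_mul hP F hk hσ
    exact h ▸ le_iSup₂ (f := fun σ _ => PTS.probReach _ σ _) σ' hσ'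
  · obtain ⟨σ', hσ', h⟩ := P.exists_rStrategy_of_rStrategy_two_mul hP F hk hσ
    exact h ▸ iInf₂_le (f := fun σ _ => PTS.probReach _ σ _) σ' hσ'
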